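/- **Setting.** Let $1\le k_1<k_2$ and $D\ge 3$ be integers, $q>1$ real, and let $\kappa>0$ be given by $\frac1\kappa=\frac1{k_1}-\frac1{k_2}$. Let $d_D\ge1$ be an integer; for $1\le\ell\le D-1$ let $\delta_\ell\ge1$ be integers with $\delta_1=1$, $\delta_\ell<\delta_{\ell+1}$, let $I_\ell$ be a finite nonempty set of nonnegative integers, and for $\lambda\in I_\ell$ let $d_{\lambda,\ell}\ge1$, $\Delta_{\lambda,\ell}\ge0$ be integers with $$\Delta_{\lambda,\ell}\ge d_{\lambda,\ell},\qquad \frac{d_{\lambda,\ell}}{k_2}+1\ge\delta_\ell,\qquad \frac{d_D-1}{k_2}+1\ge\delta_\ell .$$ Let $Q,R_1,\dots,R_D\in\mathbb C[X]$ with $\deg Q\ge\deg R_D\ge\deg R_\ell$ ($1\le\ell\le D-1$) and $Q(im)\ne0$, $R_D(im)\neq0$ for all $m\in\mathbb R$. Let $\beta>0$, $\mu>\deg(R_D)+1$, $\rho>0$, $\delta>0$, $\alpha\in\mathbb R$, $\tilde\delta>0$, and let $0<\epsilon_0,r_{\mathcal T}<1$ with $\alpha+\frac{\kappa}{\log q}\log(\epsilon_0r_{\mathcal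 T})<0$. Write $D(0,r)$ for the open disc of radius $r$ centred at $0$. For continuous $h:\mathbb R\to\mathbb C$ put $\|h\|_{(\beta,\mu)}=\sup_{m}(1+|m|)^\mu e^{\beta|m|}|h(m)|$. Let $C_{\lambda,\ell}(m,\epsilon)$ and $F_n(m,\epsilon)$ ($n\ge0$) be continuous in $m\in\mathbb R$ and holomorphic in $\epsilon\in D(0,\epsilon_0)$, with $\sup_\epsilon\|C_{\lambda,\ell}(\cdot,\epsilon)\|_{(\beta,\mu)}<\infty$ and, for some $C_F>0$, $\|F_n(\cdot,\epsilon)\|_{(\beta,\mu)}\le C_F\rho^{-n}q^{n(n-1)/(2k_1)}$ for all $n$ and $\epsilon$. Let $\varsigma\ge2$, indices $p\in\{0,\dots,\varsigma-1\}$ being taken cyclically, and let $(\mathcal E_p)_p$ be a good covering: open sectors with vertex $0$ and radius $\epsilon_0$, such that $\mathcal E_j\cap\mathcal E_k\ne\emptyset$ if and only if $j$ and $k$ are equal or cyclically adjacent, whose union is a neighbourhood of $0$ with $0$ removed. For each $p$ let $U_{\mathfrak d_p}$ be an open unbounded sector with vertex $0$ and bisecting direction $\mathfrak d_p$, such that $U_{\mathfrak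 d_p}\cup D(0,\rho)$ has positive distance to $-\delta$. Put $$\mathcal R_{\mathfrak d_p}^b=\Big\{T\in\mathbb C\setminus\{0\}:\ \Big|1+\frac{e^{i\mathfrak d_p}}{T}r\Big|>\tilde\delta\ \text{ for all } r\ge0\Big\}\cap D(0,\epsilon_0r_{\mathcal T}).$$ For $k>0$ let $\mathrm{Exp}^{\mathfrak d_p}_{(k,\beta,\mu,\alpha,\rho)}$ be the space of continuous $h$ on $(U_{\mathfrak d_p}\cup\overline D(0,\rho))\times\mathbb R$, holomorphic in $\tau\in U_{\mathfrak d_p}\cup D(0,\rho)$, with $$\|h\|_{(k,\beta,\mu,\alpha,\rho)}=\sup_{\tau,m}\,(1+|m|)^\mu e^{\beta|m|}\exp\Big(-\frac{k\log^2|\tau+\delta|}{2\log q}-\alpha\log|\tau+\delta|\Big)|h(\tau,m)|<\infty .$$ For each $p$ let $\psi_{k_1}^{\mathfrak d_p}(\cdot,\cdot,\epsilon)\in\mathrm{Exp}^{\mathfrak d_p}_{(k_1,\beta,\mu,\alpha,\rho)}$, with norms bounded uniformly in $\epsilon\in D(0,\epsilon_0)$, be equal to $\sum_{n\ge0}F_n(m,\epsilon)\,\tau^n/(q^{1/k_1})^{n(n-1)/2}$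 for $\tau\in D(0,\rho)$. Let $\varpi>0$, and for each $p$ and each $\epsilon\in D(0,\epsilon_0)$ let $w_{k_1}^{\mathfrak d_p}(\cdot,\cdot,\epsilon)\in\mathrm{Exp}^{\mathfrak d_p}_{(\kappa,\beta,\mu,\alpha,\rho)}$ have norm at most $\varpi$ and solve, for $\tau\in U_{\mathfrak d_p}\cup\overline D(0,\rho)$ and $m\in\mathbb R$, the equation (with $w=w_{k_1}^{\mathfrak d_p}$, $\psi=\psi_{k_1}^{\mathfrak d_p}$) $$\frac{Q(im)\,\tau^{k_1}}{(q^{1/k_1})^{k_1(k_1-1)/2}}\,w(\tau,m,\epsilon)=\frac{\tau^{d_D+k_1}R_D(im)}{(q^{1/k_1})^{(d_D+k_1)(d_D+k_1-1)/2}}\,w(q^{-d_D/\kappa}\tau,m,\epsilon)+\frac{\tau^{k_1}}{(q^{1/k_1})^{k_1(k_1-1)/2}}\,\psi(\tau,m,\epsilon)$$ $$+\sum_{\ell=1}^{D-1}\sum_{\lambda\in I_\ell}\frac{\epsilon^{\Delta_{\lambda,\ell}-d_{\lambda,\ell}}\,\tau^{d_{\lambda,\ell}+k_1}}{(q^{1/k_1})^{(d_{\lambda,\ell}+k_1)(d_{\lambda,\ell}+k_1-1)/2}}\frac1{(2\pi)^{1/2}}\int_{-\infty}^{\infty}C_{\lambda,\ell}(m-m_1,\epsilon)R_\ell(im_1)\,w\big(q^{\delta_\ell-\frac{d_{\lambda,\ell}}{k_1}-1}\tau,m_1,\epsilon\big)\,dm_1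 .$$ The $q$-Laplace transform of order $\kappa$ in direction $\gamma$ is $$\mathcal L^{\gamma}_{q;1/\kappa}(f)(\tau)=\frac1{\pi_{q^{1/\kappa}}}\int_{\mathbb R_+e^{i\gamma}}\frac{f(u)}{\Theta_{q^{1/\kappa}}(u/\tau)}\frac{du}u,\qquad \Theta_{q^{1/\kappa}}(x)=\sum_{n\in\mathbb Z}q^{-\frac{n(n-1)}{2\kappa}}x^n,\qquad \pi_{q^{1/\kappa}}=\frac{\log q}{\kappa}\prod_{n\ge0}\Big(1-q^{-\frac{n+1}{\kappa}}\Big)^{-1}.$$ **Lemma.** Let $0\le p\le\varsigma-1$ and assume $U_{\mathfrak d_p}\cap U_{\mathfrak d_{p+1}}=\emptyset$. Then there exist $K_p>0$ and $M_p\in\mathbb R$ such that for all $\epsilon\in\mathcal E_p\cap\mathcal E_{p+1}$, $\tau\in\mathcal R^b_{\mathfrak d_p}\cap\mathcal R^b_{\mathfrak d_{p+1}}$ and $m\in\mathbb R$ the integrals defining $\mathcal L^{\mathfrak d_{p}}_{q;1/\kappa}(w^{\mathfrak d_{p}}_{k_1})(\tau,m,\epsilon)$ and $\mathcal L^{\mathfrak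 d_{p+1}}_{q;1/\kappa}(w^{\mathfrak d_{p+1}}_{k_1})(\tau,m,\epsilon)$ (transforms in the first variable) converge absolutely, and $$\Big|\mathcal L^{\mathfrak d_{p+1}}_{q;1/\kappa}(w^{\mathfrak d_{p+1}}_{k_1})(\tau,m,\epsilon)-\mathcal L^{\mathfrak d_{p}}_{q;1/\kappa}(w^{\mathfrak d_{p}}_{k_1})(\tau,m,\epsilon)\Big|\le K_p\,e^{-\beta|m|}(1+|m|)^{-\mu}\exp\Big(-\frac{\kappa}{2\log q}\log^2|\tau|\Big)|\tau|^{M_p}.$$ -/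

import Mathlib

open Complex Set Metric Topology MeasureTheory Polynomial

noncomputable section

namespace QDiff

/-- The open unbounded sector with vertex at `0`, bisecting direction `d` and half-opening `θ`. -/
def unboundedSector (d θ : ℝ) : Set ℂ :=
  {z | ∃ r : ℝ, 0 < r ∧ ∃ φ : ℝ, |φ - d| < θ ∧ z = (r : ℂ) * exp ((φ : ℂ) * I)}

/-- The open bounded sector with vertex at `0`, radius `R`, bisecting direction `d` and
half-opening `θ`. -/
def boundedSector (d θ R : ℝ) : Set ℂ := unboundedSector d θ ∩ ball 0 R

/-- The Jacobi theta function `Θ_{q^{1/k}}(x) = ∑_{n ∈ ℤ} q^{-n(n-1)/(2k)} x^n`, `x ≠ 0`. -/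
def theta (q k : ℝ) (x : ℂ) : ℂ :=
  ∑' n : ℤ, ((q ^ (-((n : ℝ) * ((n : ℝ) - 1)) / (2 * k)) : ℝ) : ℂ) * x ^ n

/-- `π_{q^{1/k}} = (log q / k) ∏_{n ≥ 0} (1 - q^{-(n+1)/k})⁻¹`. -/
def piConst (q k : ℝ) : ℝ :=
  Real.log q / k * ∏' n : ℕ, (1 - 1 / q ^ (((n : ℝ) + 1) / k))⁻¹

/-- The integrand of the `q`-Laplace transform on the half-line `u = r e^{iγ}`, `r > 0`, on which
`du / u = dr / r`. -/
def laplaceIntegrand (q k γ : ℝ) (f : ℂ → ℂ) (T : ℂ) (r : ℝ) : ℂ :=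
  f ((r : ℂ) * exp ((γ : ℂ) * I)) / theta q k ((r : ℂ) * exp ((γ : ℂ) * I) / T) / (r : ℂ)

/-- The `q`-Laplace transform of order `k` in direction `γ`,
`(1 / π_{q^{1/k}}) ∫_{L_γ} f(u) / Θ_{q^{1/k}}(u / T) du / u`. -/
def qLaplace (q k γ : ℝ) (f : ℂ → ℂ) (T : ℂ) : ℂ :=
  1 / (piConst q k : ℂ) * ∫ r in Ioi (0 : ℝ), laplaceIntegrand q k γ f T r

/-- The domain `R_{γ,η} = {T ≠ 0 : |1 + e^{iγ} r / T| > η for all r ≥ 0}`. -/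
def laplaceDomain (γ η : ℝ) : Set ℂ :=
  {T | T ≠ 0 ∧ ∀ r : ℝ, 0 ≤ r → η < ‖1 + exp ((γ : ℂ) * I) / T * (r : ℂ)‖}

/-- Elements of `E_{(β,μ)}` of norm at most `B`. -/
structure MemE (β μ : ℝ) (h : ℝ → ℂ) (B : ℝ) : Prop where
  cont : Continuous h
  bound : ∀ m : ℝ, (1 + |m|) ^ μ * Real.exp (β * |m|) * ‖h m‖ ≤ B

/-- Elements of norm at most `B` of the space `Exp_{(k,β,μ,α,ρ)}` on the sector `U`, with shift
`δ`. -/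
structure MemExp (q δ : ℝ) (U : Set ℂ) (k β μ α ρ : ℝ) (h : ℂ → ℝ → ℂ) (B : ℝ) : Prop where
  cont : ContinuousOn (fun x : ℂ × ℝ => h x.1 x.2) ((U ∪ closedBall 0 ρ) ×ˢ univ)
  holo : ∀ m : ℝ, DifferentiableOn ℂ (fun τ => h τ m) (U ∪ ball 0 ρ)
  bound : ∀ τ ∈ U ∪ closedBall (0 : ℂ) ρ, ∀ m : ℝ,
    (1 + |m|) ^ μ * Real.exp (β * |m|) *
      Real.exp (-(k * Real.log ‖τ + (δ : ℂ)‖ ^ 2 / (2 * Real.log q))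
        - α * Real.log ‖τ + (δ : ℂ)‖) * ‖h τ m‖ ≤ B

/-- The factor `(q^{1/k})^{n(n-1)/2}`. -/
def borelFactor (q k : ℝ) (n : ℕ) : ℝ := q ^ ((n : ℝ) * ((n : ℝ) - 1) / (2 * k))

/-- The product `(h₁ *^R h₂)(m) = ∫ h₁(m - m₁) R(i m₁) h₂(m₁) dm₁`. -/
def conv (R : ℂ[X]) (h₁ h₂ : ℝ → ℂ) (m : ℝ) : ℂ :=
  ∫ m₁ : ℝ, h₁ (m - m₁) * R.eval (I * (m₁ : ℂ)) * h₂ m₁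

/-- The numbers, polynomials, coefficients `C_{λ,ℓ}(m, ε)` and `F_n(m, ε)` of the equation,
together with the assumptions made on them. -/
structure EquationData where
  k₁ : ℕ
  k₂ : ℕ
  D : ℕ
  q : ℝ
  dD : ℕ
  /-- the exponents `δ_ℓ`, `1 ≤ ℓ ≤ D - 1` -/
  dil : ℕ → ℕ
  /-- the index sets `I_ℓ` -/
  ind : ℕ → Finset ℕ
  /-- `d_{λ,ℓ}` is `d ℓ λ` -/
  d : ℕ → ℕ → ℕ
  /-- `Δ_{λ,ℓ}` is `Del ℓ λ` -/
  Del : ℕ → ℕ → ℕ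
  Q : ℂ[X]
  /-- the polynomials `R_ℓ`, `1 ≤ ℓ ≤ D` -/
  R : ℕ → ℂ[X]
  β : ℝ
  μ : ℝ
  ε₀ : ℝ
  ρ : ℝ
  /-- `C_{λ,ℓ}(m, ε)` is `C ℓ λ m ε` -/
  C : ℕ → ℕ → ℝ → ℂ → ℂ
  /-- `F_n(m, ε)` is `F n m ε` -/
  F : ℕ → ℝ → ℂ → ℂ
  one_le_k₁ : 1 ≤ k₁
  k₁_lt_k₂ : k₁ < k₂
  three_le_D : 3 ≤ D
  one_lt_q : 1 < q
  one_le_dD : 1 ≤ dD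
  ind_nonempty : ∀ ℓ ∈ Finset.Icc 1 (D - 1), (ind ℓ).Nonempty
  one_le_dil : ∀ ℓ ∈ Finset.Icc 1 (D - 1), 1 ≤ dil ℓ
  one_le_d : ∀ ℓ ∈ Finset.Icc 1 (D - 1), ∀ l ∈ ind ℓ, 1 ≤ d ℓ l
  dil_one : dil 1 = 1
  dil_lt : ∀ ℓ : ℕ, 1 ≤ ℓ → ℓ + 1 ≤ D - 1 → dil ℓ < dil (ℓ + 1)
  d_le_Del : ∀ ℓ ∈ Finset.Icc 1 (D - 1), ∀ l ∈ ind ℓ, d ℓ l ≤ Del ℓ l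
  dil_le : ∀ ℓ ∈ Finset.Icc 1 (D - 1), ∀ l ∈ ind ℓ, (dil ℓ : ℝ) ≤ (d ℓ l : ℝ) / k₂ + 1
  dil_le' : ∀ ℓ ∈ Finset.Icc 1 (D - 1), (dil ℓ : ℝ) ≤ ((dD : ℝ) - 1) / k₂ + 1
  deg_RD_le : (R D).degree ≤ Q.degree
  deg_R_le : ∀ ℓ ∈ Finset.Icc 1 (D - 1), (R ℓ).degree ≤ (R D).degree
  Q_ne : ∀ m : ℝ, Q.eval (I * (m : ℂ)) ≠ 0
  RD_ne : ∀ m : ℝ, (R D).eval (I * (m : ℂ)) ≠ 0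
  β_pos : 0 < β
  lt_μ : ((R D).natDegree : ℝ) + 1 < μ
  ε₀_pos : 0 < ε₀
  ρ_pos : 0 < ρ
  C_mem : ∀ ℓ ∈ Finset.Icc 1 (D - 1), ∀ l ∈ ind ℓ, ∃ B : ℝ, 0 < B ∧
    ∀ ε ∈ ball (0 : ℂ) ε₀, MemE β μ (fun m => C ℓ l m ε) B
  C_holo : ∀ ℓ ∈ Finset.Icc 1 (D - 1), ∀ l ∈ ind ℓ, ∀ m : ℝ,
    DifferentiableOn ℂ (fun ε => C ℓ l m ε) (ball 0 ε₀)
  F_mem : ∃ B : ℝ, 0 < B ∧ ∀ n : ℕ, ∀ ε ∈ ball (0 : ℂ) ε₀,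
    MemE β μ (fun m => F n m ε) (B * (ρ ^ n)⁻¹ * borelFactor q k₁ n)
  F_holo : ∀ n : ℕ, ∀ m : ℝ, DifferentiableOn ℂ (fun ε => F n m ε) (ball 0 ε₀)

namespace EquationData

/-- The number `κ` with `1/κ = 1/k₁ - 1/k₂`. -/
def kappa (P : EquationData) : ℝ := (1 / (P.k₁ : ℝ) - 1 / (P.k₂ : ℝ))⁻¹

/-- `ψ` is, for each `ε`, an analytic continuation to `U` (in the space `Exp` of order `k₁`, with
norm bounded uniformly in `ε`) of the series `∑ F_n(m,ε) τ^n / (q^{1/k₁})^{n(n-1)/2}`. -/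
structure IsForcing (P : EquationData) (δ α : ℝ) (U : Set ℂ) (ψ : ℂ → ℝ → ℂ → ℂ) : Prop where
  mem : ∃ B : ℝ, 0 < B ∧ ∀ ε ∈ ball (0 : ℂ) P.ε₀,
    MemExp P.q δ U P.k₁ P.β P.μ α P.ρ (fun τ m => ψ τ m ε) B
  hasSum : ∀ ε ∈ ball (0 : ℂ) P.ε₀, ∀ m : ℝ, ∀ τ ∈ ball (0 : ℂ) P.ρ,
    HasSum (fun n : ℕ => P.F n m ε * τ ^ n / (borelFactor P.q P.k₁ n : ℂ)) (ψ τ m ε)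

/-- The convolution equation satisfied by `w = w_{k₁}` on `U ∪ closedBall 0 ρ`, with forcing
term `ψ`. -/
def IsSolution (P : EquationData) (U : Set ℂ) (ψ w : ℂ → ℝ → ℂ → ℂ) : Prop :=
  ∀ ε ∈ ball (0 : ℂ) P.ε₀, ∀ τ ∈ U ∪ closedBall (0 : ℂ) P.ρ, ∀ m : ℝ,
    P.Q.eval (I * (m : ℂ)) * (τ ^ P.k₁ / (borelFactor P.q P.k₁ P.k₁ : ℂ)) * w τ m ε =
      τ ^ (P.dD + P.k₁) / (borelFactor P.q P.k₁ (P.dD + P.k₁) : ℂ) *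
          (P.R P.D).eval (I * (m : ℂ)) *
          w (((P.q ^ (-(P.dD : ℝ) / P.kappa) : ℝ) : ℂ) * τ) m ε
      + ∑ ℓ ∈ Finset.Icc 1 (P.D - 1), ∑ l ∈ P.ind ℓ,
          ε ^ (P.Del ℓ l - P.d ℓ l) * τ ^ (P.d ℓ l + P.k₁) /
              (borelFactor P.q P.k₁ (P.d ℓ l + P.k₁) : ℂ) *
            (1 / ((Real.sqrt (2 * Real.pi) : ℝ) : ℂ)) *
            conv (P.R ℓ) (fun m' => P.C ℓ l m' ε)
              (fun m' => w (((P.q ^ ((P.dil ℓ : ℝ) - (P.d ℓ l : ℝ) / P.k₁ - 1) : ℝ) : ℂ) * τ)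
                m' ε) m
      + τ ^ P.k₁ / (borelFactor P.q P.k₁ P.k₁ : ℂ) * ψ τ m ε

end EquationData

/-- A good covering in `ℂ \ {0}` by open sectors of radius `ε₀`; indices are cyclic. -/
structure IsGoodCovering {n : ℕ} [NeZero n] (ε₀ : ℝ) (E : Fin n → Set ℂ) : Prop where
  sector : ∀ p, ∃ a θ : ℝ, 0 < θ ∧ E p = boundedSector a θ ε₀
  inter : ∀ j k, (E j ∩ E k).Nonempty ↔ (j = k ∨ k = j + 1 ∨ j = k + 1)
  cover : ∃ V ∈ 𝓝 (0 : ℂ), (⋃ p, E p) = V \ {0}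

end QDiff

end

/-!
Put `a = κ / (2 log q)` and `L = log |τ|`.

*The two solutions agree near `0`.* Every dilation in the convolution equation is a contraction and
every term on its right-hand side has an additional factor `τ`. So, if `v` is the difference of the
two solutions, `sup_m |R_D(im) v(τ, m)|` is `O(|τ|)` times the supremum of the same quantity over a
punctured disc of radius `|τ|` (`exists_contraction`). Iterating gives `v = 0` near the origin, and
the identity theorem gives `v = 0` on `D(0, ρ)` (`eqOn_ball_of_isSolution`).

*The theta function.* `|Θ(x)|` is at least a constant times `exp (a log² |x|) |x| ^ (1/2)` as long
as `x` stays away from the direction of the negative axis (`exists_le_norm_theta`). The quotient of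
the two sides is periodic in `log x`, so compactness reduces this to the fact that `Θ` has no zero
off the negative axis (`theta_ne_zero`). That follows from Jacobi's triple product, obtained from
the `q`-binomial theorem by letting the number of factors tend to infinity
(`finite_triple_product`).

*The contour.* In the variable `Z = log u` the two transforms are integrals over horizontal lines.
The arguments of the two directions are chosen so that the arc between them avoids the direction of
`-τ` (`exists_arguments`); this is possible because both solutions are the same single-valued
function on the disc, so either arc may be used. Cauchy's theorem replaces the difference of the
two integrals by the contributions of the half-lines `|u| ≥ ρ / 2` and of an arc of radius `ρ / 2`
(`integrable_and_norm_sub_le_of_eq_left`). On these sets `log² |u + δ| - log² |u|` is bounded, and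
`a log² |u| - a log² |u / τ| = -a L² + 2 a L log |u|`. Hence all three contributions are
`O(exp (-a L²) |τ| ^ M)` with `M = 1 / 2 + 2 a log (ρ / 2)`; the condition on `α` makes the
integrals over the half-lines converge uniformly in `τ` (`norm_qLaplace_sub_le`).
-/

namespace QDiff

/-! ### Gaussian binomial coefficients and the finite triple product -/

/-- The `p`-factorial `(1 - p)(1 - p²)⋯(1 - pⁿ)`, not normalised by powers of `1 - p`. -/
noncomputable def qFactorial (p : ℝ) (n : ℕ) : ℝ := ∏ j ∈ Finset.range n, (1 - p ^ (j + 1))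

/-- Gaussian binomial coefficients, defined by the `p`-Pascal rule. -/
noncomputable def gaussBinom (p : ℝ) : ℕ → ℕ → ℝ
  | _, 0 => 1
  | 0, _ + 1 => 0
  | M + 1, k + 1 => p ^ (k + 1) * gaussBinom p M (k + 1) + gaussBinom p M k

theorem gaussBinom_zero_right (p : ℝ) (M : ℕ) : gaussBinom p M 0 = 1 := by
  cases M <;> simp [gaussBinom]

theorem gaussBinom_eq_zero_of_lt (p : ℝ) {M k : ℕ} (h : M < k) : gaussBinom p M k = 0 := by
  induction M generalizing k with
  | zero =>
    obtain ⟨k, rfl⟩ : ∃ j, k = j + 1 := ⟨k - 1, by omega⟩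
    simp [gaussBinom]
  | succ M ih =>
    obtain ⟨k, rfl⟩ : ∃ j, k = j + 1 := ⟨k - 1, by omega⟩
    simp [gaussBinom, ih (k := k + 1) (by omega), ih (k := k) (by omega)]

theorem gaussBinom_mul_qFactorial (p : ℝ) (k l : ℕ) :
    gaussBinom p (k + l) k * (qFactorial p k * qFactorial p l) = qFactorial p (k + l) := by
  obtain ⟨M, hM⟩ : ∃ M, M = k + l := ⟨_, rfl⟩
  induction M generalizing k l with
  | zero =>
    obtain ⟨rfl, rfl⟩ : k = 0 ∧ l = 0 := by omega
    simp [gaussBinom, qFactorial]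
  | succ M ih =>
    rcases k with _ | k
    · simp [gaussBinom_zero_right, qFactorial]
    rcases l with _ | l
    · have h1 := ih k 0 (by omega)
      have h2 : gaussBinom p k (k + 1) = 0 := gaussBinom_eq_zero_of_lt p (by omega)
      simp only [add_zero] at h1 ⊢
      rw [gaussBinom, h2]
      have e : qFactorial p (k + 1) = qFactorial p k * (1 - p ^ (k + 1)) := by
        simp [qFactorial, Finset.prod_range_succ]
      rw [e]
      linear_combination (1 - p ^ (k + 1)) * h1
    · have h1 := ih (k + 1) l (by omega)
      have h2 := ih k (l + 1) (by omega)
      have e : ∀ n, qFactorial p (n + 1) = qFactorial p n * (1 - p ^ (n + 1)) := by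
        intro n; simp [qFactorial, Finset.prod_range_succ]
      rw [show k + 1 + (l + 1) = (k + l + 1) + 1 by ring, gaussBinom, e (k + l + 1)]
      rw [show k + 1 + l = k + l + 1 by ring] at h1
      rw [show k + (l + 1) = k + l + 1 by ring] at h2
      rw [e l] at h2 ⊢
      rw [e k] at h1 ⊢
      linear_combination p ^ (k + 1) * (1 - p ^ (l + 1)) * h1 + (1 - p ^ (k + 1)) * h2

/-- The `p`-binomial theorem. -/
theorem prod_one_add_mul_pow (p : ℝ) (M : ℕ) (x : ℂ) :
    ∏ j ∈ Finset.range M, (1 + x * (p : ℂ) ^ j) =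
      ∑ k ∈ Finset.range (M + 1), (p : ℂ) ^ (k.choose 2) * (gaussBinom p M k : ℂ) * x ^ k := by
  induction M generalizing x with
  | zero => simp [gaussBinom]
  | succ M ih =>
    have h1 : ∏ j ∈ Finset.range M, (1 + x * (p : ℂ) ^ (j + 1)) =
        ∏ j ∈ Finset.range M, (1 + (x * p) * (p : ℂ) ^ j) := by
      refine Finset.prod_congr rfl fun j _ => ?_
      ring
    rw [Finset.prod_range_succ', h1, ih, Finset.sum_range_succ' _ (M + 1)]
    have h2 : ∑ k ∈ Finset.range (M + 1), (p : ℂ) ^ ((k + 1).choose 2) *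
          (gaussBinom p (M + 1) (k + 1) : ℂ) * x ^ (k + 1) =
        ∑ k ∈ Finset.range (M + 1), (p : ℂ) ^ ((k + 1).choose 2) *
          (gaussBinom p M (k + 1) : ℂ) * (x * p) ^ (k + 1) +
        x * ∑ k ∈ Finset.range (M + 1), (p : ℂ) ^ (k.choose 2) *
          (gaussBinom p M k : ℂ) * (x * p) ^ k := by
      rw [Finset.mul_sum, ← Finset.sum_add_distrib]
      refine Finset.sum_congr rfl fun k _ => ?_
      rw [gaussBinom, Nat.choose_succ_succ' k 1, Nat.choose_one_right]
      push_cast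
      ring
    have h3 := Finset.sum_range_succ' (fun k => (p : ℂ) ^ (k.choose 2) *
      (gaussBinom p M k : ℂ) * (x * p) ^ k) (M + 1)
    rw [Finset.sum_range_succ] at h3
    simp only [gaussBinom_eq_zero_of_lt p (Nat.lt_succ_self M), gaussBinom_zero_right] at h3
    rw [h2, gaussBinom_zero_right]
    simp at h3 ⊢
    linear_combination h3

/-- Pulling `x p^(-i)` out of each factor `1 + x p^(-i)`, `1 ≤ i ≤ N`. -/
theorem prod_one_add_shift {p : ℝ} (hp : 0 < p) (N : ℕ) {x : ℂ} (hx : x ≠ 0) :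
    (∏ j ∈ Finset.range N, (1 + x * ((p : ℂ) ^ N)⁻¹ * (p : ℂ) ^ j)) *
        (p : ℂ) ^ ((N + 1).choose 2) =
      x ^ N * ∏ j ∈ Finset.range N, (1 + x⁻¹ * (p : ℂ) ^ (j + 1)) := by
  have hp' : (p : ℂ) ≠ 0 := by exact_mod_cast hp.ne'
  induction N with
  | zero => simp
  | succ N ih =>
    have h1 : ∏ j ∈ Finset.range N, (1 + x * ((p : ℂ) ^ (N + 1))⁻¹ * (p : ℂ) ^ (j + 1)) =
        ∏ j ∈ Finset.range N, (1 + x * ((p : ℂ) ^ N)⁻¹ * (p : ℂ) ^ j) := by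
      refine Finset.prod_congr rfl fun j _ => ?_
      field_simp
      ring
    rw [Finset.prod_range_succ', h1, Finset.prod_range_succ _ N, Nat.choose_succ_succ' (N + 1) 1,
      Nat.choose_one_right, pow_add]
    have h2 : (1 + x * ((p : ℂ) ^ (N + 1))⁻¹ * (p : ℂ) ^ 0) * (p : ℂ) ^ (N + 1) =
        x * (1 + x⁻¹ * (p : ℂ) ^ (N + 1)) := by
      field_simp
      ring
    linear_combination ((1 + x * ((p : ℂ) ^ (N + 1))⁻¹ * (p : ℂ) ^ 0) * (p : ℂ) ^ (N + 1)) * ih +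
      x ^ N * (∏ j ∈ Finset.range N, (1 + x⁻¹ * (p : ℂ) ^ (j + 1))) * h2

/-- The Gaussian binomial `[2N, N + n]`, for an integer `n`; it vanishes for `|n| > N`. -/
noncomputable def centralGaussBinom (p : ℝ) (N : ℕ) (n : ℤ) : ℝ :=
  if 0 ≤ (N : ℤ) + n then gaussBinom p (2 * N) ((N : ℤ) + n).toNat else 0

/-- The finite form of Jacobi's triple product. -/
theorem finite_triple_product {p : ℝ} (hp : 0 < p) (N : ℕ) {x : ℂ} (hx : x ≠ 0) :
    ∑' n : ℤ, (centralGaussBinom p N n : ℂ) *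
        (((p ^ ((n : ℝ) * ((n : ℝ) - 1) / 2) : ℝ) : ℂ) * x ^ n) =
      (∏ j ∈ Finset.range N, (1 + x * (p : ℂ) ^ j)) *
        ∏ j ∈ Finset.range N, (1 + x⁻¹ * (p : ℂ) ^ (j + 1)) := by
  have hp' : (p : ℂ) ≠ 0 := by exact_mod_cast hp.ne'
  have hxN : x ^ N ≠ 0 := pow_ne_zero _ hx
  have hinj : Function.Injective (fun k : ℕ => (k : ℤ) - N) := fun a b h => by simpa using h
  -- the product is `x ^ (-N)` times a power of `p` times `∏ (1 + x p ^ (j - N))` over `j < 2N`,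
  -- to which the binomial theorem applies
  rw [← mul_right_inj' hxN, mul_left_comm (x ^ N), ← prod_one_add_shift hp N hx, ← mul_assoc]
  have h1 : (∏ j ∈ Finset.range N, (1 + x * (p : ℂ) ^ j)) *
      ∏ j ∈ Finset.range N, (1 + x * ((p : ℂ) ^ N)⁻¹ * (p : ℂ) ^ j) =
      ∏ j ∈ Finset.range (2 * N), (1 + (x * ((p : ℂ) ^ N)⁻¹) * (p : ℂ) ^ j) := by
    rw [two_mul, Finset.prod_range_add, mul_comm]
    congr 1
    refine Finset.prod_congr rfl fun j _ => ?_
    rw [pow_add]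
    field_simp
  rw [h1, prod_one_add_mul_pow, tsum_eq_sum (s := (Finset.range (2 * N + 1)).image
    (fun k : ℕ => (k : ℤ) - N)), Finset.sum_image fun a _ b _ h => hinj h, Finset.mul_sum,
    Finset.sum_mul]
  · refine Finset.sum_congr rfl fun k _ => ?_
    have h2 : centralGaussBinom p N ((k : ℤ) - N) = gaussBinom p (2 * N) k := by
      simp [centralGaussBinom]
    have h3 : (p ^ ((((k : ℤ) - N : ℤ) : ℝ) * ((((k : ℤ) - N : ℤ) : ℝ) - 1) / 2) : ℝ) *
        p ^ (N * k) = p ^ (k.choose 2) * p ^ ((N + 1).choose 2) := by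
      rw [← Real.rpow_natCast, ← Real.rpow_natCast, ← Real.rpow_natCast, ← Real.rpow_add hp,
        ← Real.rpow_add hp, Nat.cast_choose_two, Nat.cast_choose_two]
      congr 1
      push_cast
      ring
    have h3' := congrArg (fun r : ℝ => (r : ℂ)) h3
    simp only [ofReal_mul, ofReal_pow] at h3'
    have h4 : x ^ ((k : ℤ) - N) * x ^ N = x ^ k := by
      rw [← zpow_natCast, ← zpow_natCast, ← zpow_add₀ hx]
      congr 1
      ring
    rw [h2, mul_pow, inv_pow, ← pow_mul]
    have h5 : (p : ℂ) ^ (N * k) ≠ 0 := pow_ne_zero _ hp'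
    field_simp
    rw [← h4]
    linear_combination (gaussBinom p (2 * N) k : ℂ) * (x ^ ((k : ℤ) - N) * x ^ N) * h3'
  · intro n hn
    have : centralGaussBinom p N n = 0 := by
      rw [centralGaussBinom]
      split_ifs with h
      · refine gaussBinom_eq_zero_of_lt p ?_
        by_contra hlt
        refine hn (Finset.mem_image.2 ⟨((N : ℤ) + n).toNat, Finset.mem_range.2 (by omega), ?_⟩)
        simp only [Int.toNat_of_nonneg h]
        ring
      · rfl
    simp [this]

/-! ### The theta function: zeros and lower bound -/

theorem qFactorial_tendsto {p : ℝ} (hp : 0 < p) (hp1 : p < 1) :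
    ∃ E : ℝ, 0 < E ∧ Filter.Tendsto (qFactorial p) Filter.atTop (𝓝 E) ∧
      ∀ n, E ≤ qFactorial p n := by
  have hs : Summable fun j : ℕ => ‖-p ^ (j + 1)‖ := by
    simp only [norm_neg, norm_pow, Real.norm_of_nonneg hp.le]
    exact (summable_nat_add_iff 1).2 (summable_geometric_of_lt_one hp.le hp1)
  have hlt : ∀ j : ℕ, p ^ (j + 1) < 1 := fun j => pow_lt_one₀ hp.le hp1 (by omega)
  have ht : Filter.Tendsto (qFactorial p) Filter.atTop (𝓝 (∏' j : ℕ, (1 + -p ^ (j + 1)))) := by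
    have := (multipliable_one_add_of_summable hs).hasProd.tendsto_prod_nat
    refine this.congr fun n => Finset.prod_congr rfl fun j _ => ?_
    ring
  have hne : ∏' j : ℕ, (1 + -p ^ (j + 1)) ≠ 0 :=
    tprod_one_add_ne_zero_of_summable (fun j => by have := hlt j; linarith) hs
  have hpos : ∀ n, 0 ≤ qFactorial p n :=
    fun n => Finset.prod_nonneg fun j _ => by have := hlt j; linarith
  have hanti : Antitone (qFactorial p) := by
    refine antitone_nat_of_succ_le fun n => ?_
    rw [qFactorial, Finset.prod_range_succ]
    exact mul_le_of_le_one_right (hpos n) (by have := pow_pos hp (n + 1); linarith)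
  have hle : ∀ n, ∏' j : ℕ, (1 + -p ^ (j + 1)) ≤ qFactorial p n := hanti.le_of_tendsto ht
  have h0 : 0 ≤ ∏' j : ℕ, (1 + -p ^ (j + 1)) := ge_of_tendsto' ht hpos
  exact ⟨_, lt_of_le_of_ne h0 hne.symm, ht, hle⟩

/-- The central Gaussian binomials are uniformly bounded and converge to `1 / ∏ (1 - pⁿ)`. -/
theorem centralGaussBinom_tendsto {p : ℝ} (hp : 0 < p) (hp1 : p < 1) :
    ∃ E : ℝ, 0 < E ∧ (∃ B : ℝ, ∀ N n, |centralGaussBinom p N n| ≤ B) ∧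
      ∀ n, Filter.Tendsto (fun N => centralGaussBinom p N n) Filter.atTop (𝓝 E⁻¹) := by
  obtain ⟨E, hE, ht, hle⟩ := qFactorial_tendsto hp hp1
  have hpos : ∀ n, 0 < qFactorial p n := fun n => hE.trans_le (hle n)
  have heq : ∀ k l, gaussBinom p (k + l) k =
      qFactorial p (k + l) / (qFactorial p k * qFactorial p l) := fun k l => by
    rw [eq_div_iff (mul_pos (hpos k) (hpos l)).ne', gaussBinom_mul_qFactorial]
  have hle1 : ∀ n, qFactorial p n ≤ 1 := fun n =>
    Finset.prod_le_one (fun j _ => by have := pow_le_one₀ hp.le hp1.le (n := j + 1); linarith)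
      fun j _ => by have := pow_pos hp (j + 1); linarith
  have hbd : ∀ k l, |gaussBinom p (k + l) k| ≤ 1 / (E * E) := fun k l => by
    rw [heq, abs_of_pos (div_pos (hpos _) (mul_pos (hpos k) (hpos l)))]
    exact div_le_div₀ zero_le_one (hle1 _) (mul_pos hE hE)
      (mul_le_mul (hle _) (hle _) hE.le (hpos _).le)
  refine ⟨E, hE, ⟨1 / (E * E), fun N n => ?_⟩, fun n => ?_⟩
  · rw [centralGaussBinom]
    split_ifs with h
    · rcases le_or_gt ((N : ℤ) + n).toNat (2 * N) with h1 | h1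
      · obtain ⟨l, hl⟩ := Nat.exists_eq_add_of_le h1
        rw [hl]
        exact hbd _ _
      · rw [gaussBinom_eq_zero_of_lt p h1, abs_zero]
        positivity
    · rw [abs_zero]
      positivity
  · have h1 : Filter.Tendsto (fun N : ℕ => qFactorial p (2 * N) /
        (qFactorial p ((N : ℤ) + n).toNat * qFactorial p ((N : ℤ) - n).toNat)) Filter.atTop
        (𝓝 (E / (E * E))) := by
      have a1 : Filter.Tendsto (fun N : ℕ => 2 * N) Filter.atTop Filter.atTop :=
        Filter.tendsto_atTop_mono (fun N => by simp only [id]; omega) Filter.tendsto_id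
      have a2 : ∀ n : ℤ, Filter.Tendsto (fun N : ℕ => ((N : ℤ) + n).toNat) Filter.atTop
          Filter.atTop := fun n => Filter.tendsto_atTop.2 fun b => by
        filter_upwards [Filter.eventually_ge_atTop (b + n.natAbs)] with N hN
        omega
      exact (ht.comp a1).div ((ht.comp (a2 n)).mul (ht.comp (a2 (-n)))) (by positivity)
    rw [show E⁻¹ = E / (E * E) by field_simp]
    refine h1.congr' ?_
    filter_upwards [Filter.eventually_ge_atTop n.natAbs] with N hN
    have h2 : 2 * N = ((N : ℤ) + n).toNat + ((N : ℤ) - n).toNat := by omega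
    rw [centralGaussBinom, if_pos (by omega), h2, heq]

theorem theta_exp_term (q k : ℝ) (hq : 1 < q) (hk : 0 < k) (Z : ℂ) (n : ℤ) :
    ((q ^ (-((n : ℝ) * ((n : ℝ) - 1)) / (2 * k)) : ℝ) : ℂ) * exp Z ^ n =
      jacobiTheta₂_term n ((Z + Real.log q / (2 * k)) / (2 * Real.pi * I))
        (Real.log q / (2 * Real.pi * k) * I) := by
  have hπ : (Real.pi : ℂ) ≠ 0 := by exact_mod_cast Real.pi_ne_zero
  have hk' : (k : ℂ) ≠ 0 := by exact_mod_cast hk.ne'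
  rw [jacobiTheta₂_term, Real.rpow_def_of_pos (by linarith), ofReal_exp, ← exp_int_mul, ← exp_add]
  congr 1
  push_cast
  field_simp
  ring_nf
  simp only [I_sq]
  ring

theorem im_thetaModulus_pos {q k : ℝ} (hq : 1 < q) (hk : 0 < k) :
    0 < ((Real.log q / (2 * Real.pi * k) * I : ℂ)).im := by
  have : (Real.log q / (2 * Real.pi * k) * I : ℂ) =
      ((Real.log q / (2 * Real.pi * k) : ℝ) : ℂ) * I := by push_cast; rfl
  rw [this, im_ofReal_mul, I_im, mul_one]
  have := Real.log_pos hq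
  positivity

/-- In the logarithmic variable the theta function is a two-variable Jacobi theta function. -/
theorem theta_exp {q k : ℝ} (hq : 1 < q) (hk : 0 < k) (Z : ℂ) :
    theta q k (exp Z) = jacobiTheta₂ ((Z + Real.log q / (2 * k)) / (2 * Real.pi * I))
      (Real.log q / (2 * Real.pi * k) * I) :=
  tsum_congr fun n => theta_exp_term q k hq hk Z n

theorem differentiable_theta_exp {q k : ℝ} (hq : 1 < q) (hk : 0 < k) :
    Differentiable ℂ fun Z => theta q k (exp Z) := by
  simp only [theta_exp hq hk]
  intro Z
  exact (differentiableAt_jacobiTheta₂_fst _ (im_thetaModulus_pos hq hk)).comp Z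
    (f := fun Z : ℂ => (Z + Real.log q / (2 * k)) / (2 * Real.pi * I)) (by fun_prop)

theorem summable_theta {q k : ℝ} (hq : 1 < q) (hk : 0 < k) {x : ℂ} (hx : x ≠ 0) :
    Summable fun n : ℤ => ((q ^ (-((n : ℝ) * ((n : ℝ) - 1)) / (2 * k)) : ℝ) : ℂ) * x ^ n := by
  rw [← exp_log hx]
  simp only [theta_exp_term q k hq hk]
  exact (summable_jacobiTheta₂_term_iff _ _).2 (im_thetaModulus_pos hq hk)

/-- The theta function vanishes only on the negative real axis. The finite triple products converge
to a nonzero multiple of `theta` and also to an infinite product without vanishing factors. -/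
theorem theta_ne_zero {q k : ℝ} (hq : 1 < q) (hk : 0 < k) {x : ℂ} (hx : x ≠ 0)
    (h : ∀ r : ℝ, 0 ≤ r → 1 + x * (r : ℂ) ≠ 0) : theta q k x ≠ 0 := by
  set p : ℝ := q ^ (-1 / k) with hpdef
  have hq0 : 0 < q := by linarith
  have hp : 0 < p := Real.rpow_pos_of_pos hq0 _
  have hp1 : p < 1 := Real.rpow_lt_one_of_one_lt_of_neg hq (div_neg_of_neg_of_pos (by norm_num) hk)
  have hw : ∀ n : ℤ, q ^ (-((n : ℝ) * ((n : ℝ) - 1)) / (2 * k)) =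
      p ^ ((n : ℝ) * ((n : ℝ) - 1) / 2) := fun n => by
    rw [hpdef, ← Real.rpow_mul hq0.le]
    congr 1
    field_simp
  have hsum := summable_theta hq hk hx
  obtain ⟨E, hE, ⟨B, hB⟩, ht⟩ := centralGaussBinom_tendsto hp hp1
  have hL := tendsto_tsum_of_dominated_convergence (𝓕 := Filter.atTop)
    (f := fun (N : ℕ) (n : ℤ) => (centralGaussBinom p N n : ℂ) *
        (((q ^ (-((n : ℝ) * ((n : ℝ) - 1)) / (2 * k)) : ℝ) : ℂ) * x ^ n))
    (hsum.norm.mul_left B)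
    (fun n => ((continuous_ofReal.tendsto _).comp (ht n)).mul_const _)
    (Filter.Eventually.of_forall fun N n => by
      rw [norm_mul, norm_real]
      exact mul_le_mul_of_nonneg_right (hB N n) (norm_nonneg _))
  rw [tsum_mul_left] at hL
  have hs1 : Summable fun j : ℕ => ‖x * (p : ℂ) ^ j‖ := by
    simp only [norm_mul, norm_pow, norm_real, Real.norm_of_nonneg hp.le]
    exact (summable_geometric_of_lt_one hp.le hp1).mul_left _
  have hs2 : Summable fun j : ℕ => ‖x⁻¹ * (p : ℂ) ^ (j + 1)‖ := by
    simp only [norm_mul, norm_pow, norm_real, Real.norm_of_nonneg hp.le]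
    exact ((summable_nat_add_iff 1).2 (summable_geometric_of_lt_one hp.le hp1)).mul_left _
  have hR := (multipliable_one_add_of_summable hs1).hasProd.tendsto_prod_nat.mul
    (multipliable_one_add_of_summable hs2).hasProd.tendsto_prod_nat
  have heq := tendsto_nhds_unique hL (hR.congr fun N => by
    rw [← finite_triple_product hp N hx]
    simp only [hw])
  have h1 : ∏' j : ℕ, (1 + x * (p : ℂ) ^ j) ≠ 0 :=
    tprod_one_add_ne_zero_of_summable (fun j => by
      have := h (p ^ j) (by positivity)
      push_cast at this
      exact this) hs1
  have h2 : ∏' j : ℕ, (1 + x⁻¹ * (p : ℂ) ^ (j + 1)) ≠ 0 :=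
    tprod_one_add_ne_zero_of_summable (fun j hj => by
      have hp' : (p : ℂ) ≠ 0 := by exact_mod_cast hp.ne'
      refine h (p ^ (j + 1))⁻¹ (by positivity) ?_
      push_cast
      field_simp at hj ⊢
      linear_combination hj) hs2
  intro h0
  have h3 := mul_ne_zero h1 h2
  rw [← heq] at h3
  refine h3 ?_
  rw [show (∑' n : ℤ, ((q ^ (-((n : ℝ) * ((n : ℝ) - 1)) / (2 * k)) : ℝ) : ℂ) * x ^ n) = 0 from h0,
    mul_zero]

theorem theta_mul_rpow {q : ℝ} (k : ℝ) (hq : 1 < q) {x : ℂ} (hx : x ≠ 0) :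
    theta q k (x * ((q ^ (1 / k) : ℝ) : ℂ)) = x * ((q ^ (1 / k) : ℝ) : ℂ) * theta q k x := by
  have hq0 : 0 < q := by linarith
  have hQ : ((q ^ (1 / k) : ℝ) : ℂ) ≠ 0 := by
    exact_mod_cast (Real.rpow_pos_of_pos hq0 _).ne'
  rw [theta, theta, ← (Equiv.addRight (1 : ℤ)).tsum_eq, ← tsum_mul_left]
  refine tsum_congr fun n => ?_
  have h1 : (q ^ (-((((n + 1 : ℤ)) : ℝ) * (((n + 1 : ℤ) : ℝ) - 1)) / (2 * k)) : ℝ) *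
      (q ^ (1 / k)) ^ n = q ^ (-((n : ℝ) * ((n : ℝ) - 1)) / (2 * k)) := by
    rw [← Real.rpow_intCast, ← Real.rpow_mul hq0.le, ← Real.rpow_add hq0]
    congr 1
    push_cast
    ring
  have h1' := congrArg (fun r : ℝ => (r : ℂ)) h1
  simp only [ofReal_mul, ofReal_zpow] at h1'
  rw [Equiv.coe_addRight, mul_zpow, zpow_add_one₀ hx, zpow_add_one₀ hQ]
  linear_combination (x * x ^ n * ((q ^ (1 / k) : ℝ) : ℂ)) * h1'

/-- Away from the negative real axis, `|Θ(x)|` is at least a constant times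
`exp (k log² |x| / (2 log q)) |x| ^ (1/2)`. Here `x = exp Z`; the quotient of the two sides
has periods `log q / k` and `2πi`, so a compact set of `Z` is enough. -/
theorem exists_le_norm_theta {q k η : ℝ} (hq : 1 < q) (hk : 0 < k) (hη : 0 < η) :
    ∃ c : ℝ, 0 < c ∧ ∀ Z : ℂ, (∀ r : ℝ, 0 ≤ r → η ≤ ‖1 + exp Z * (r : ℂ)‖) →
      c * Real.exp (k / (2 * Real.log q) * Z.re ^ 2 + Z.re / 2) ≤ ‖theta q k (exp Z)‖ := by
  have hlog : 0 < Real.log q := Real.log_pos hq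
  have hq0 : 0 < q := by linarith
  set G : ℂ → ℝ := fun Z =>
    ‖theta q k (exp Z)‖ * Real.exp (-(k / (2 * Real.log q) * Z.re ^ 2 + Z.re / 2)) with hG
  set S : Set ℂ := {Z | ∀ r : ℝ, 0 ≤ r → η ≤ ‖1 + exp Z * (r : ℂ)‖} with hS
  have hSclosed : IsClosed S := by
    simp only [hS, ofPred_forall]
    refine isClosed_iInter fun r => isClosed_iInter fun _ => ?_
    exact isClosed_le continuous_const (by fun_prop)
  have hGcont : Continuous G :=
    (differentiable_theta_exp hq hk).continuous.norm.mul (by fun_prop)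
  have hpos : ∀ Z ∈ S, 0 < G Z := fun Z hZ => by
    refine mul_pos (norm_pos_iff.2 (theta_ne_zero hq hk (exp_ne_zero _) fun r hr h0 => ?_))
      (Real.exp_pos _)
    have := hZ r hr
    rw [h0, norm_zero] at this
    linarith
  have hqk : exp ((Real.log q / k : ℝ) : ℂ) = ((q ^ (1 / k) : ℝ) : ℂ) := by
    rw [← ofReal_exp, Real.rpow_def_of_pos hq0]
    congr 2
    ring
  have hper1 : ∀ Z, G (Z + ((Real.log q / k : ℝ) : ℂ)) = G Z := fun Z => by
    simp only [hG]
    rw [exp_add, hqk, theta_mul_rpow k hq (exp_ne_zero _), norm_mul, ← hqk, ← exp_add, norm_exp,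
      mul_comm (Real.exp _), mul_assoc, ← Real.exp_add]
    congr 2
    simp only [add_re, ofReal_re]
    field_simp
    ring
  have hper2 : ∀ Z, G (Z + (2 * Real.pi : ℝ) * I) = G Z := fun Z => by
    simp only [hG]
    have : exp (Z + (2 * Real.pi : ℝ) * I) = exp Z := by
      push_cast
      exact exp_periodic Z
    rw [this]
    simp
  have hmem1 : ∀ Z, Z + ((Real.log q / k : ℝ) : ℂ) ∈ S ↔ Z ∈ S := fun Z => by
    have key : ∀ c : ℝ, ∀ Z : ℂ, Z ∈ S → Z + (c : ℂ) ∈ S := fun c Z hZ r hr => by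
      have := hZ (Real.exp c * r) (by positivity)
      rwa [ofReal_mul, ← mul_assoc, ofReal_exp, ← exp_add] at this
    refine ⟨fun h => ?_, key _ Z⟩
    have := key (-(Real.log q / k)) _ h
    rwa [ofReal_neg, add_neg_cancel_right] at this
  have hmem2 : ∀ Z, Z + (2 * Real.pi : ℝ) * I ∈ S ↔ Z ∈ S := fun Z => by
    have : exp (Z + (2 * Real.pi : ℝ) * I) = exp Z := by
      push_cast
      exact exp_periodic Z
    simp only [hS, mem_ofPred_eq, this]
  obtain ⟨c, hc, hcG⟩ : ∃ c : ℝ, 0 < c ∧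
      ∀ Z ∈ (Icc 0 (Real.log q / k) ×ℂ Icc 0 (2 * Real.pi)) ∩ S, c ≤ G Z := by
    have hcomp : IsCompact ((Icc 0 (Real.log q / k) ×ℂ Icc 0 (2 * Real.pi)) ∩ S) :=
      (isCompact_Icc.reProdIm isCompact_Icc).inter_right hSclosed
    rcases (((Icc 0 (Real.log q / k) ×ℂ Icc 0 (2 * Real.pi)) ∩ S)).eq_empty_or_nonempty with he | hn
    · exact ⟨1, one_pos, by simp [he]⟩
    · obtain ⟨Z₀, hZ₀, hmin⟩ := hcomp.exists_isMinOn hn hGcont.continuousOn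
      exact ⟨G Z₀, hpos Z₀ hZ₀.2, fun Z hZ => hmin hZ⟩
  refine ⟨c, hc, fun Z hZ => ?_⟩
  -- translate `Z` into the period rectangle, using that `S` and `G` are both periodic
  have hred : ∃ Z' ∈ (Icc 0 (Real.log q / k) ×ℂ Icc 0 (2 * Real.pi)) ∩ S, G Z = G Z' := by
    have hP1 : Function.Periodic (fun t : ℝ => (G (Z + (t - Z.re : ℝ)), Z + (t - Z.re : ℝ) ∈ S))
        (Real.log q / k) := fun t => by
      have : Z + ((t + Real.log q / k - Z.re : ℝ) : ℂ) =
        Z + (t - Z.re : ℝ) + ((Real.log q / k : ℝ) : ℂ) := by push_cast; ring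
      simp only [this, hper1, hmem1]
    obtain ⟨s, hs, hs'⟩ := hP1.exists_mem_Ico₀ (by positivity) Z.re
    have hP2 : Function.Periodic (fun t : ℝ => (G (Z + (s - Z.re : ℝ) + (t - Z.im : ℝ) * I),
        Z + (s - Z.re : ℝ) + (t - Z.im : ℝ) * I ∈ S)) (2 * Real.pi) := fun t => by
      have : Z + (s - Z.re : ℝ) + ((t + 2 * Real.pi - Z.im : ℝ) : ℂ) * I =
        Z + (s - Z.re : ℝ) + (t - Z.im : ℝ) * I + (2 * Real.pi : ℝ) * I := by push_cast; ring
      simp only [this, hper2, hmem2]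
    obtain ⟨t, ht, ht'⟩ := hP2.exists_mem_Ico₀ (by positivity) Z.im
    simp only [sub_self, ofReal_zero, add_zero, zero_mul, Prod.mk.injEq, eq_iff_iff] at hs' ht'
    refine ⟨_, ⟨?_, ht'.2.1 (hs'.2.1 hZ)⟩, hs'.1.trans ht'.1⟩
    rw [mem_reProdIm]
    have a1 : (Z + (s - Z.re : ℝ) + (t - Z.im : ℝ) * I).re = s := by simp
    have a2 : (Z + (s - Z.re : ℝ) + (t - Z.im : ℝ) * I).im = t := by simp
    rw [a1, a2]
    exact ⟨Ico_subset_Icc_self hs, Ico_subset_Icc_self ht⟩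
  obtain ⟨Z', hZ', hGZ⟩ := hred
  have h1 : c ≤ G Z := hGZ ▸ hcG Z' hZ'
  have h2 := mul_le_mul_of_nonneg_right h1
    (Real.exp_pos (k / (2 * Real.log q) * Z.re ^ 2 + Z.re / 2)).le
  rwa [hG, mul_assoc, ← Real.exp_add, neg_add_cancel, Real.exp_zero, mul_one] at h2

/-! ### Growth of functions in the spaces `Exp` and `E` -/

theorem MemExp.norm_le {q δ : ℝ} {U : Set ℂ} {k β μ α ρ : ℝ} {h : ℂ → ℝ → ℂ} {B : ℝ}
    (hh : MemExp q δ U k β μ α ρ h B) {τ : ℂ} (hτ : τ ∈ U ∪ closedBall (0 : ℂ) ρ) (m : ℝ) :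
    ‖h τ m‖ ≤ B * Real.exp (-β * |m|) * (1 + |m|) ^ (-μ) *
      Real.exp (k / (2 * Real.log q) * Real.log ‖τ + (δ : ℂ)‖ ^ 2 +
        α * Real.log ‖τ + (δ : ℂ)‖) := by
  have h1 : (0 : ℝ) < 1 + |m| := by positivity
  have h2 : (0 : ℝ) < (1 + |m|) ^ μ := Real.rpow_pos_of_pos h1 _
  have h3 := hh.bound τ hτ m
  set X := k / (2 * Real.log q) * Real.log ‖τ + (δ : ℂ)‖ ^ 2 + α * Real.log ‖τ + (δ : ℂ)‖ with hX
  have h4 : -(k * Real.log ‖τ + (δ : ℂ)‖ ^ 2 / (2 * Real.log q)) - α * Real.log ‖τ + (δ : ℂ)‖ =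
      -X := by rw [hX]; ring
  rw [h4, Real.exp_neg X] at h3
  rw [neg_mul, Real.exp_neg (β * |m|), Real.rpow_neg h1.le]
  calc ‖h τ m‖ = ((1 + |m|) ^ μ * Real.exp (β * |m|) * (Real.exp X)⁻¹ * ‖h τ m‖) *
        ((Real.exp (β * |m|))⁻¹ * ((1 + |m|) ^ μ)⁻¹ * Real.exp X) := by field_simp
    _ ≤ B * ((Real.exp (β * |m|))⁻¹ * ((1 + |m|) ^ μ)⁻¹ * Real.exp X) := by gcongr
    _ = _ := by ring

theorem MemExp.continuous_right {q δ : ℝ} {U : Set ℂ} {k β μ α ρ : ℝ} {h : ℂ → ℝ → ℂ} {B : ℝ}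
    (hh : MemExp q δ U k β μ α ρ h B) {τ : ℂ} (hτ : τ ∈ U ∪ closedBall (0 : ℂ) ρ) :
    Continuous (h τ) :=
  hh.cont.comp_continuous (f := fun m : ℝ => (τ, m)) (by fun_prop) fun _ => ⟨hτ, mem_univ _⟩

theorem MemExp.continuousOn_left {q δ : ℝ} {U : Set ℂ} {k β μ α ρ : ℝ} {h : ℂ → ℝ → ℂ} {B : ℝ}
    (hh : MemExp q δ U k β μ α ρ h B) (m : ℝ) :
    ContinuousOn (fun τ => h τ m) (U ∪ closedBall 0 ρ) :=
  hh.cont.comp (f := fun τ : ℂ => (τ, m)) (by fun_prop) fun _ hτ => ⟨hτ, mem_univ _⟩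

theorem MemE.norm_le {β μ B : ℝ} {h : ℝ → ℂ} (hh : MemE β μ h B) (hβ : 0 < β) (m : ℝ) :
    ‖h m‖ ≤ B * (1 + |m|) ^ (-μ) := by
  have h1 : (0 : ℝ) < 1 + |m| := by positivity
  have h2 : (0 : ℝ) < (1 + |m|) ^ μ := Real.rpow_pos_of_pos h1 _
  rw [Real.rpow_neg h1.le, ← div_eq_mul_inv, le_div_iff₀ h2]
  refine le_trans ?_ (hh.bound m)
  have h3 : 1 ≤ Real.exp (β * |m|) := Real.one_le_exp (by positivity)
  nlinarith [mul_nonneg h2.le (norm_nonneg (h m))]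

/-- On a bounded set at positive distance from `-δ` the growth function of `Exp` is bounded. -/
theorem exists_growth_le_of_norm_le {a α δ c₀ R : ℝ} (ha : 0 ≤ a) (hδ : 0 < δ) (hc₀ : 0 < c₀) :
    ∃ C : ℝ, 0 < C ∧ ∀ u : ℂ, c₀ ≤ ‖u + (δ : ℂ)‖ → ‖u‖ ≤ R →
      Real.exp (a * Real.log ‖u + (δ : ℂ)‖ ^ 2 + α * Real.log ‖u + (δ : ℂ)‖) ≤ C := by
  set B := |Real.log c₀| + |Real.log (R + δ)| with hB
  refine ⟨Real.exp (a * B ^ 2 + |α| * B), Real.exp_pos _, fun u hu hR' => ?_⟩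
  have h1 : ‖u + (δ : ℂ)‖ ≤ R + δ := by
    refine (norm_add_le _ _).trans ?_
    rw [norm_real, Real.norm_of_nonneg hδ.le]
    linarith
  have h2 : |Real.log ‖u + (δ : ℂ)‖| ≤ B := by
    have l1 := Real.log_le_log hc₀ hu
    have l2 := Real.log_le_log (hc₀.trans_le hu) h1
    rw [abs_le]
    constructor
    · linarith [neg_abs_le (Real.log c₀), abs_nonneg (Real.log (R + δ))]
    · linarith [le_abs_self (Real.log (R + δ)), abs_nonneg (Real.log c₀)]
  have h3 : Real.log ‖u + (δ : ℂ)‖ ^ 2 ≤ B ^ 2 := by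
    rw [← sq_abs]
    gcongr
  have h4 : α * Real.log ‖u + (δ : ℂ)‖ ≤ |α| * B := by
    refine (le_abs_self _).trans ?_
    rw [abs_mul]
    gcongr
  gcongr

/-- Far from the origin, and at positive distance from `-δ`, the shift by `δ` changes the growth
function of `Exp` only by a bounded factor: `log |u + δ| - log |u|` is `O(1 / |u|)`. -/
theorem exists_growth_le_of_le_norm {a α δ c₀ R : ℝ} (ha : 0 ≤ a) (hδ : 0 < δ) (hc₀ : 0 < c₀)
    (hR : 0 < R) : ∃ C : ℝ, 0 < C ∧ ∀ u : ℂ, c₀ ≤ ‖u + (δ : ℂ)‖ → R ≤ ‖u‖ →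
      Real.exp (a * Real.log ‖u + (δ : ℂ)‖ ^ 2 + α * Real.log ‖u + (δ : ℂ)‖) ≤
        C * Real.exp (a * Real.log ‖u‖ ^ 2 + α * Real.log ‖u‖) := by
  set D := δ * (1 + δ / c₀) with hD
  have hDpos : 0 < D := by positivity
  refine ⟨Real.exp (a * (2 * (D * (1 + 1 / R ^ 2)) + (D / R) ^ 2) + |α| * (D / R)),
    Real.exp_pos _, fun u hu hRu => ?_⟩
  have hu0 : 0 < ‖u‖ := hR.trans_le hRu
  have hv0 : 0 < ‖u + (δ : ℂ)‖ := hc₀.trans_le hu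
  have hδn : ‖(δ : ℂ)‖ = δ := by rw [norm_real, Real.norm_of_nonneg hδ.le]
  have e1 : ‖u + (δ : ℂ)‖ ≤ ‖u‖ + δ := (norm_add_le _ _).trans (by rw [hδn])
  have e2 : ‖u‖ ≤ ‖u + (δ : ℂ)‖ + δ := by
    have := norm_sub_le (u + (δ : ℂ)) δ
    rwa [add_sub_cancel_right, hδn] at this
  have e3 : ‖u‖ ≤ ‖u + (δ : ℂ)‖ * (1 + δ / c₀) := by
    have : δ ≤ ‖u + (δ : ℂ)‖ * (δ / c₀) := by
      rw [mul_div_assoc', le_div_iff₀ hc₀]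
      nlinarith
    linarith
  set l := Real.log ‖u + (δ : ℂ)‖ - Real.log ‖u‖ with hl
  have hlabs : |l| ≤ D / ‖u‖ := by
    rw [abs_le]
    constructor
    · have h1 := Real.log_le_sub_one_of_pos (div_pos hu0 hv0)
      rw [Real.log_div hu0.ne' hv0.ne'] at h1
      have h2 : ‖u‖ / ‖u + (δ : ℂ)‖ - 1 ≤ D / ‖u‖ := by
        rw [div_sub_one hv0.ne', div_le_div_iff₀ hv0 hu0]
        nlinarith
      linarith
    · have h1 := Real.log_le_sub_one_of_pos (div_pos hv0 hu0)
      rw [Real.log_div hv0.ne' hu0.ne'] at h1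
      have h2 : ‖u + (δ : ℂ)‖ / ‖u‖ - 1 ≤ D / ‖u‖ := by
        rw [div_sub_one hu0.ne']
        gcongr
        have : δ ≤ D := by
          rw [hD]
          have : 0 < δ / c₀ := by positivity
          nlinarith
        linarith
      linarith
  have hlR : |l| ≤ D / R := hlabs.trans (by gcongr)
  have hlog : |Real.log ‖u‖| ≤ ‖u‖ * (1 + 1 / R ^ 2) := by
    have h1 : 1 / ‖u‖ ≤ ‖u‖ * (1 / R ^ 2) := by
      rw [div_le_iff₀ hu0, mul_right_comm, mul_one_div, le_div_iff₀ (by positivity)]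
      nlinarith
    rw [abs_le]
    constructor
    · have := Real.log_le_sub_one_of_pos (one_div_pos.2 hu0)
      rw [one_div, Real.log_inv, ← one_div] at this
      linarith
    · have := Real.log_le_sub_one_of_pos hu0
      have : 0 ≤ 1 / ‖u‖ := by positivity
      linarith
  have hprod : l * Real.log ‖u‖ ≤ D * (1 + 1 / R ^ 2) := by
    refine (le_abs_self _).trans ?_
    rw [abs_mul]
    calc |l| * |Real.log ‖u‖| ≤ D / ‖u‖ * (‖u‖ * (1 + 1 / R ^ 2)) := by gcongr
      _ = _ := by field_simp
  have hsq : l ^ 2 ≤ (D / R) ^ 2 := by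
    rw [← sq_abs]
    gcongr
  have hlin : α * l ≤ |α| * (D / R) := by
    refine (le_abs_self _).trans ?_
    rw [abs_mul]
    gcongr
  have hlv : Real.log ‖u + (δ : ℂ)‖ = Real.log ‖u‖ + l := by rw [hl]; ring
  rw [← Real.exp_add, hlv]
  refine Real.exp_le_exp.2 ?_
  have := mul_le_mul_of_nonneg_left (add_le_add (mul_le_mul_of_nonneg_left hprod zero_le_two) hsq) ha
  nlinarith

/-! ### Uniqueness of the solution of the convolution equation near the origin -/

theorem exists_norm_eval_le {A B : ℂ[X]} (hdeg : A.degree ≤ B.degree)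
    (hB : ∀ m : ℝ, B.eval (I * (m : ℂ)) ≠ 0) :
    ∃ C : ℝ, 0 ≤ C ∧ ∀ m : ℝ, ‖A.eval (I * (m : ℂ))‖ ≤ C * ‖B.eval (I * (m : ℂ))‖ := by
  have ht : Filter.Tendsto (fun m : ℝ => I * (m : ℂ)) (Filter.cocompact ℝ)
      (Bornology.cobounded ℂ) := by
    rw [← tendsto_norm_atTop_iff_cobounded]
    refine (tendsto_norm_cocompact_atTop (E := ℝ)).congr fun m => ?_
    simp
  obtain ⟨C₁, hC₁⟩ := ((isBigO_cobounded_of_degree_le hdeg).comp_tendsto ht).bound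
  obtain ⟨K, hK, hKC⟩ := Filter.mem_cocompact.1 hC₁
  have hcont : ContinuousOn (fun m : ℝ => A.eval (I * (m : ℂ)) / B.eval (I * (m : ℂ))) K :=
    ContinuousOn.div (by fun_prop) (by fun_prop) fun m _ => hB m
  obtain ⟨C₂, hC₂⟩ := hK.exists_bound_of_continuousOn hcont
  refine ⟨max 0 (max C₁ C₂), le_max_left _ _, fun m => ?_⟩
  by_cases hm : m ∈ K
  · have := hC₂ m hm
    rw [norm_div, div_le_iff₀ (norm_pos_iff.2 (hB m))] at this
    exact this.trans (by gcongr; exact (le_max_right _ _).trans (le_max_right _ _))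
  · have : ‖A.eval (I * (m : ℂ))‖ ≤ C₁ * ‖B.eval (I * (m : ℂ))‖ := hKC hm
    exact this.trans (by gcongr; exact (le_max_left _ _).trans (le_max_right _ _))

theorem exists_norm_eval_le_rpow (A : ℂ[X]) : ∃ C : ℝ, 0 ≤ C ∧ ∀ m : ℝ,
    ‖A.eval (I * (m : ℂ))‖ ≤ C * (1 + |m|) ^ (A.natDegree : ℝ) := by
  have hdeg : A.degree ≤ ((X + Polynomial.C (1 : ℂ)) ^ A.natDegree).degree := by
    rw [degree_pow, degree_X_add_C, nsmul_one]
    exact degree_le_natDegree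
  obtain ⟨C, hC, h⟩ := exists_norm_eval_le hdeg fun m => by
    rw [eval_pow, eval_add, eval_X, eval_C]
    refine pow_ne_zero _ fun h0 => ?_
    have := congrArg re h0
    simp at this
  refine ⟨C, hC, fun m => (h m).trans ?_⟩
  rw [eval_pow, eval_add, eval_X, eval_C, norm_pow, Real.rpow_natCast]
  gcongr
  refine (norm_add_le _ _).trans ?_
  simp [add_comm]

theorem integrable_one_add_abs_rpow {μ : ℝ} (hμ : 1 < μ) :
    Integrable fun x : ℝ => (1 + |x|) ^ (-μ) := by
  simpa using integrable_one_add_norm (E := ℝ) (μ := volume) (r := μ) (by simpa using hμ)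

/-- The product `h ↦ g *^R h` is bounded for the norm `sup_m |S(im) h(m)|`, where `S` dominates
`R` on the imaginary axis. -/
theorem norm_conv_sub_le {R S : ℂ[X]} {C B μ A s : ℝ} {g h₁ h₂ : ℝ → ℂ} (hμ : 1 < μ) (hC : 0 ≤ C)
    (hR : ∀ m : ℝ, ‖R.eval (I * (m : ℂ))‖ ≤ C * ‖S.eval (I * (m : ℂ))‖)
    (hg : Continuous g) (hB : ∀ m, ‖g m‖ ≤ B * (1 + |m|) ^ (-μ))
    (hh₁ : Continuous h₁) (hh₂ : Continuous h₂)
    (hA₁ : ∀ m : ℝ, ‖S.eval (I * (m : ℂ)) * h₁ m‖ ≤ A)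
    (hA₂ : ∀ m : ℝ, ‖S.eval (I * (m : ℂ)) * h₂ m‖ ≤ A)
    (hs : ∀ m : ℝ, ‖S.eval (I * (m : ℂ)) * (h₁ m - h₂ m)‖ ≤ s) (m : ℝ) :
    ‖conv R g h₁ m - conv R g h₂ m‖ ≤ B * C * (∫ x : ℝ, (1 + |x|) ^ (-μ)) * s := by
  have hint := (integrable_one_add_abs_rpow hμ).comp_sub_left m
  have key : ∀ (h : ℝ → ℂ) (A : ℝ), (∀ m : ℝ, ‖S.eval (I * (m : ℂ)) * h m‖ ≤ A) → ∀ x : ℝ,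
      ‖g (m - x) * R.eval (I * (x : ℂ)) * h x‖ ≤ B * C * A * (1 + |m - x|) ^ (-μ) := by
    intro h A hA x
    rw [mul_assoc, norm_mul, norm_mul (R.eval _)]
    have h1 : ‖R.eval (I * (x : ℂ))‖ * ‖h x‖ ≤ C * A := by
      calc ‖R.eval (I * (x : ℂ))‖ * ‖h x‖ ≤ C * ‖S.eval (I * (x : ℂ))‖ * ‖h x‖ := by
            gcongr; exact hR x
        _ = C * ‖S.eval (I * (x : ℂ)) * h x‖ := by rw [norm_mul]; ring
        _ ≤ C * A := by gcongr; exact hA x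
    calc ‖g (m - x)‖ * (‖R.eval (I * (x : ℂ))‖ * ‖h x‖) ≤ (B * (1 + |m - x|) ^ (-μ)) * (C * A) :=
          mul_le_mul (hB _) h1 (by positivity) ((norm_nonneg _).trans (hB _))
      _ = _ := by ring
  have hI : ∀ h : ℝ → ℂ, Continuous h → (∀ m : ℝ, ‖S.eval (I * (m : ℂ)) * h m‖ ≤ A) →
      Integrable fun x : ℝ => g (m - x) * R.eval (I * (x : ℂ)) * h x := fun h hh hA =>
    (hint.const_mul (B * C * A)).mono' (by fun_prop)
      (Filter.Eventually.of_forall (key h A hA))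
  rw [conv, conv, ← integral_sub (hI h₁ hh₁ hA₁) (hI h₂ hh₂ hA₂)]
  have h2 := norm_integral_le_of_norm_le (hint.const_mul (B * C * s))
    (Filter.Eventually.of_forall (key (fun x => h₁ x - h₂ x) s hs))
  rw [integral_const_mul, integral_sub_left_eq_self (fun x : ℝ => (1 + |x|) ^ (-μ))] at h2
  simp only [mul_sub] at h2
  calc _ ≤ _ := h2
    _ = _ := by ring

theorem EquationData.kappa_pos (P : EquationData) : 0 < P.kappa := by
  have h1 : (0 : ℝ) < P.k₁ := by exact_mod_cast P.one_le_k₁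
  have h2 : (P.k₁ : ℝ) < P.k₂ := by exact_mod_cast P.k₁_lt_k₂
  exact inv_pos.2 (sub_pos.2 (one_div_lt_one_div_of_lt h1 h2))

theorem EquationData.dilation_nonpos (P : EquationData) {ℓ l : ℕ}
    (hℓ : ℓ ∈ Finset.Icc 1 (P.D - 1)) (hl : l ∈ P.ind ℓ) :
    (P.dil ℓ : ℝ) - (P.d ℓ l : ℝ) / P.k₁ - 1 ≤ 0 := by
  have h1 : (0 : ℝ) < P.k₁ := by exact_mod_cast P.one_le_k₁
  have h2 : (P.k₁ : ℝ) < P.k₂ := by exact_mod_cast P.k₁_lt_k₂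
  have h3 := P.dil_le ℓ hℓ l hl
  have h4 : (P.d ℓ l : ℝ) / P.k₂ ≤ (P.d ℓ l : ℝ) / P.k₁ := by gcongr
  linarith

theorem EquationData.borelFactor_pos (P : EquationData) (k : ℝ) (n : ℕ) :
    0 < borelFactor P.q k n :=
  Real.rpow_pos_of_pos (by linarith [P.one_lt_q]) _

/-- The contraction behind uniqueness. If `w₁`, `w₂` solve the equation with the same forcing term
on the disc, then `sup_m |R_D(im) (w₁ - w₂)(τ, m)|` is at most `O(|τ|)` times a bound for the same
quantity on the punctured disc of radius `|τ|`: all dilations occurring in the equation are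
contractions, and every term on its right-hand side carries an additional factor `τ`. -/
theorem exists_contraction (P : EquationData) {U₁ U₂ : Set ℂ} {ψ₁ ψ₂ w₁ w₂ : ℂ → ℝ → ℂ → ℂ} {A : ℝ}
    (hsol₁ : P.IsSolution U₁ ψ₁ w₁) (hsol₂ : P.IsSolution U₂ ψ₂ w₂)
    {ε : ℂ} (hε : ε ∈ ball (0 : ℂ) P.ε₀)
    (hψ : ∀ τ ∈ ball (0 : ℂ) P.ρ, ∀ m, ψ₁ τ m ε = ψ₂ τ m ε)
    (hc₁ : ∀ τ ∈ ball (0 : ℂ) P.ρ, Continuous fun m => w₁ τ m ε)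
    (hc₂ : ∀ τ ∈ ball (0 : ℂ) P.ρ, Continuous fun m => w₂ τ m ε)
    (hA₁ : ∀ τ ∈ ball (0 : ℂ) P.ρ, ∀ m : ℝ, ‖(P.R P.D).eval (I * (m : ℂ)) * w₁ τ m ε‖ ≤ A)
    (hA₂ : ∀ τ ∈ ball (0 : ℂ) P.ρ, ∀ m : ℝ, ‖(P.R P.D).eval (I * (m : ℂ)) * w₂ τ m ε‖ ≤ A) :
    ∃ Λ : ℝ, 0 ≤ Λ ∧ ∀ τ ∈ ball (0 : ℂ) P.ρ, τ ≠ 0 → ‖τ‖ ≤ 1 → ∀ s : ℝ, 0 ≤ s →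
      (∀ σ : ℂ, σ ≠ 0 → ‖σ‖ ≤ ‖τ‖ → ∀ m : ℝ,
        ‖(P.R P.D).eval (I * (m : ℂ)) * (w₁ σ m ε - w₂ σ m ε)‖ ≤ s) →
      ∀ m : ℝ, ‖(P.R P.D).eval (I * (m : ℂ)) * (w₁ τ m ε - w₂ τ m ε)‖ ≤ ‖τ‖ * Λ * s := by
  have hq0 : 0 < P.q := by linarith [P.one_lt_q]
  have hμ : 1 < P.μ := by
    have := P.lt_μ
    have : (0 : ℝ) ≤ (P.R P.D).natDegree := by positivity
    linarith
  obtain ⟨CQ, hCQ, hQ⟩ := exists_norm_eval_le P.deg_RD_le P.Q_ne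
  choose! CR hCR hR using fun ℓ hℓ => exists_norm_eval_le (P.deg_R_le ℓ hℓ) P.RD_ne
  choose! B hB hC using P.C_mem
  set J : ℝ := ∫ x : ℝ, (1 + |x|) ^ (-P.μ) with hJ
  have hJ0 : 0 ≤ J := integral_nonneg fun x => by positivity
  have hb := P.borelFactor_pos P.k₁
  set Λ₁ : ℝ := 1 / borelFactor P.q P.k₁ (P.dD + P.k₁) +
    ∑ ℓ ∈ Finset.Icc 1 (P.D - 1), ∑ l ∈ P.ind ℓ,
      ‖ε‖ ^ (P.Del ℓ l - P.d ℓ l) / borelFactor P.q P.k₁ (P.d ℓ l + P.k₁) *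
        (1 / Real.sqrt (2 * Real.pi)) * (B ℓ l * CR ℓ * J) with hΛ₁
  have hΛ₁0 : 0 ≤ Λ₁ := by
    refine add_nonneg (one_div_nonneg.2 (hb _).le) (Finset.sum_nonneg fun ℓ hℓ =>
      Finset.sum_nonneg fun l hl => ?_)
    have h1 := hB ℓ hℓ l hl
    have h2 := hCR ℓ hℓ
    have h3 := hb (P.d ℓ l + P.k₁)
    positivity
  refine ⟨CQ * borelFactor P.q P.k₁ P.k₁ * Λ₁, by have := hb P.k₁; positivity,
    fun τ hτ hτ0 hτ1 s hs hσ m => ?_⟩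
  have hτn : 0 < ‖τ‖ := norm_pos_iff.2 hτ0
  have hτρ : ‖τ‖ < P.ρ := by simpa using hτ
  -- the dilations occurring in the equation map the punctured disc of radius `‖τ‖` into itself
  have hdil : ∀ x : ℝ, x ≤ 0 → ((P.q ^ x : ℝ) : ℂ) * τ ≠ 0 ∧ ‖((P.q ^ x : ℝ) : ℂ) * τ‖ ≤ ‖τ‖ := by
    intro x hx
    have h1 : 0 < P.q ^ x := Real.rpow_pos_of_pos hq0 x
    have h2 : P.q ^ x ≤ 1 := Real.rpow_le_one_of_one_le_of_nonpos P.one_lt_q.le hx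
    refine ⟨mul_ne_zero (by exact_mod_cast h1.ne') hτ0, ?_⟩
    rw [norm_mul, norm_real, Real.norm_of_nonneg h1.le]
    exact mul_le_of_le_one_left hτn.le h2
  have hball : ∀ σ : ℂ, ‖σ‖ ≤ ‖τ‖ → σ ∈ ball (0 : ℂ) P.ρ := fun σ h => by
    simpa using h.trans_lt hτρ
  have hmem : ∀ U : Set ℂ, τ ∈ U ∪ closedBall (0 : ℂ) P.ρ := fun U =>
    Or.inr (ball_subset_closedBall hτ)
  have hdiff := congrArg₂ (· - ·) (hsol₁ ε hε τ (hmem _) m) (hsol₂ ε hε τ (hmem _) m)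
  simp only [hψ τ hτ m] at hdiff
  set c : ℂ := ((P.q ^ (-(P.dD : ℝ) / P.kappa) : ℝ) : ℂ) with hc
  have hcτ := hdil (-(P.dD : ℝ) / P.kappa)
    (div_nonpos_of_nonpos_of_nonneg (by simp) P.kappa_pos.le)
  rw [← hc] at hcτ
  set T : (ℂ → ℝ → ℂ → ℂ) → ℕ → ℕ → ℂ := fun w ℓ l =>
    ε ^ (P.Del ℓ l - P.d ℓ l) * τ ^ (P.d ℓ l + P.k₁) /
      (borelFactor P.q P.k₁ (P.d ℓ l + P.k₁) : ℂ) *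
        (1 / ((Real.sqrt (2 * Real.pi) : ℝ) : ℂ)) *
        conv (P.R ℓ) (fun m' => P.C ℓ l m' ε)
          (fun m' => w (((P.q ^ ((P.dil ℓ : ℝ) - (P.d ℓ l : ℝ) / P.k₁ - 1) : ℝ) : ℂ) * τ) m' ε) m
    with hT
  have heq : P.Q.eval (I * (m : ℂ)) * (τ ^ P.k₁ / (borelFactor P.q P.k₁ P.k₁ : ℂ)) *
      (w₁ τ m ε - w₂ τ m ε) =
      τ ^ (P.dD + P.k₁) / (borelFactor P.q P.k₁ (P.dD + P.k₁) : ℂ) *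
        ((P.R P.D).eval (I * (m : ℂ)) * (w₁ (c * τ) m ε - w₂ (c * τ) m ε)) +
      ∑ ℓ ∈ Finset.Icc 1 (P.D - 1), ∑ l ∈ P.ind ℓ, (T w₁ ℓ l - T w₂ ℓ l) := by
    simp only [Finset.sum_sub_distrib]
    linear_combination hdiff
  have hpow : ∀ d : ℕ, 1 ≤ d → ‖τ‖ ^ (d + P.k₁) ≤ ‖τ‖ ^ (P.k₁ + 1) := fun d hd =>
    pow_le_pow_of_le_one hτn.le hτ1 (by omega)
  have hbn : ∀ n, ‖(borelFactor P.q P.k₁ n : ℂ)‖ = borelFactor P.q P.k₁ n := fun n => by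
    rw [norm_real, Real.norm_of_nonneg (hb n).le]
  have hterm : ∀ ℓ ∈ Finset.Icc 1 (P.D - 1), ∀ l ∈ P.ind ℓ, ‖T w₁ ℓ l - T w₂ ℓ l‖ ≤
      ‖τ‖ ^ (P.k₁ + 1) * (‖ε‖ ^ (P.Del ℓ l - P.d ℓ l) / borelFactor P.q P.k₁ (P.d ℓ l + P.k₁) *
        (1 / Real.sqrt (2 * Real.pi)) * (B ℓ l * CR ℓ * J)) * s := by
    intro ℓ hℓ l hl
    have hx := hdil _ (P.dilation_nonpos hℓ hl)
    have h1 := norm_conv_sub_le hμ (hCR ℓ hℓ) (hR ℓ hℓ) (hC ℓ hℓ l hl ε hε).cont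
      ((hC ℓ hℓ l hl ε hε).norm_le P.β_pos) (hc₁ _ (hball _ hx.2)) (hc₂ _ (hball _ hx.2))
      (hA₁ _ (hball _ hx.2)) (hA₂ _ (hball _ hx.2)) (hσ _ hx.1 hx.2) m
    have h2 := hB ℓ hℓ l hl
    have h3 := hCR ℓ hℓ
    have h4 := hb (P.d ℓ l + P.k₁)
    have h5 := hpow _ (P.one_le_d ℓ hℓ l hl)
    rw [hT]
    simp only
    rw [← mul_sub, norm_mul, norm_mul, norm_div, norm_mul, norm_pow, norm_pow, norm_div, norm_one,
      hbn, norm_real, Real.norm_of_nonneg (Real.sqrt_nonneg _)]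
    calc _ ≤ ‖ε‖ ^ (P.Del ℓ l - P.d ℓ l) * ‖τ‖ ^ (P.k₁ + 1) /
            borelFactor P.q P.k₁ (P.d ℓ l + P.k₁) * (1 / Real.sqrt (2 * Real.pi)) *
            (B ℓ l * CR ℓ * J * s) := by gcongr
      _ = _ := by ring
  have hnorm : ‖P.Q.eval (I * (m : ℂ))‖ * (‖τ‖ ^ P.k₁ / borelFactor P.q P.k₁ P.k₁) *
      ‖w₁ τ m ε - w₂ τ m ε‖ ≤ ‖τ‖ ^ (P.k₁ + 1) * Λ₁ * s := by
    have h0 := congrArg norm heq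
    rw [norm_mul, norm_mul, norm_div, norm_pow, hbn] at h0
    rw [h0]
    refine (norm_add_le _ _).trans ?_
    have h1 : ‖τ ^ (P.dD + P.k₁) / (borelFactor P.q P.k₁ (P.dD + P.k₁) : ℂ) *
        ((P.R P.D).eval (I * (m : ℂ)) * (w₁ (c * τ) m ε - w₂ (c * τ) m ε))‖ ≤
        ‖τ‖ ^ (P.k₁ + 1) * (1 / borelFactor P.q P.k₁ (P.dD + P.k₁)) * s := by
      rw [norm_mul, norm_div, norm_pow, hbn, mul_one_div]
      have h4 := hb (P.dD + P.k₁)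
      have h5 := hpow _ P.one_le_dD
      have h6 := hσ _ hcτ.1 hcτ.2 m
      gcongr
    have h2 := norm_sum_le_of_le _ fun ℓ hℓ => norm_sum_le_of_le _ (hterm ℓ hℓ)
    refine (add_le_add h1 h2).trans (le_of_eq ?_)
    simp only [hΛ₁, mul_add, add_mul, Finset.mul_sum, Finset.sum_mul]
  have hτk : 0 < ‖τ‖ ^ P.k₁ := pow_pos hτn _
  have hb1 := hb P.k₁
  have h3 : ‖P.Q.eval (I * (m : ℂ))‖ * ‖w₁ τ m ε - w₂ τ m ε‖ ≤
      ‖τ‖ * borelFactor P.q P.k₁ P.k₁ * Λ₁ * s := by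
    rw [← mul_le_mul_iff_of_pos_left (div_pos hτk hb1)]
    calc _ = ‖P.Q.eval (I * (m : ℂ))‖ * (‖τ‖ ^ P.k₁ / borelFactor P.q P.k₁ P.k₁) *
          ‖w₁ τ m ε - w₂ τ m ε‖ := by ring
      _ ≤ _ := hnorm
      _ = _ := by
        field_simp
        ring
  calc ‖(P.R P.D).eval (I * (m : ℂ)) * (w₁ τ m ε - w₂ τ m ε)‖
      ≤ CQ * ‖P.Q.eval (I * (m : ℂ))‖ * ‖w₁ τ m ε - w₂ τ m ε‖ := by
        rw [norm_mul]
        gcongr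
        exact hQ m
    _ ≤ CQ * (‖τ‖ * borelFactor P.q P.k₁ P.k₁ * Λ₁ * s) := by
        rw [mul_assoc]
        gcongr
    _ = _ := by ring

/-- Two solutions of the convolution equation, on two sectors, coincide on the common disc when
their forcing terms do. -/
theorem eqOn_ball_of_isSolution (P : EquationData) {δ α ϖ c₁ c₂ : ℝ} (hδ : 0 < δ)
    {U₁ U₂ : Set ℂ} {ψ₁ ψ₂ w₁ w₂ : ℂ → ℝ → ℂ → ℂ}
    (hd₁ : 0 < c₁) (hd₁' : ∀ u ∈ U₁ ∪ ball (0 : ℂ) P.ρ, c₁ ≤ ‖u + (δ : ℂ)‖)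
    (hd₂ : 0 < c₂) (hd₂' : ∀ u ∈ U₂ ∪ ball (0 : ℂ) P.ρ, c₂ ≤ ‖u + (δ : ℂ)‖)
    (hψ₁ : P.IsForcing δ α U₁ ψ₁) (hψ₂ : P.IsForcing δ α U₂ ψ₂)
    {ε : ℂ} (hε : ε ∈ ball (0 : ℂ) P.ε₀)
    (hw₁ : MemExp P.q δ U₁ P.kappa P.β P.μ α P.ρ (fun τ m => w₁ τ m ε) ϖ)
    (hw₂ : MemExp P.q δ U₂ P.kappa P.β P.μ α P.ρ (fun τ m => w₂ τ m ε) ϖ)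
    (hsol₁ : P.IsSolution U₁ ψ₁ w₁) (hsol₂ : P.IsSolution U₂ ψ₂ w₂) (m : ℝ) :
    EqOn (fun τ => w₁ τ m ε) (fun τ => w₂ τ m ε) (ball 0 P.ρ) := by
  have hlog := Real.log_pos P.one_lt_q
  have hκ := P.kappa_pos
  have hρ := P.ρ_pos
  have hψ : ∀ τ ∈ ball (0 : ℂ) P.ρ, ∀ m, ψ₁ τ m ε = ψ₂ τ m ε := fun τ hτ m =>
    (hψ₁.hasSum ε hε m τ hτ).unique (hψ₂.hasSum ε hε m τ hτ)
  obtain ⟨CR, hCR, hR⟩ := exists_norm_eval_le_rpow (P.R P.D)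
  have hbd : ∀ (U : Set ℂ) (w : ℂ → ℝ → ℂ → ℂ) (c : ℝ), 0 < c →
      (∀ u ∈ U ∪ ball (0 : ℂ) P.ρ, c ≤ ‖u + (δ : ℂ)‖) →
      MemExp P.q δ U P.kappa P.β P.μ α P.ρ (fun τ m => w τ m ε) ϖ →
      ∃ A : ℝ, 0 ≤ A ∧ ∀ τ ∈ ball (0 : ℂ) P.ρ, ∀ m : ℝ,
        ‖(P.R P.D).eval (I * (m : ℂ)) * w τ m ε‖ ≤ A := by
    intro U w c hc hU hw
    obtain ⟨C, hC, hgr⟩ := exists_growth_le_of_norm_le (a := P.kappa / (2 * Real.log P.q)) (α := α)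
      (R := P.ρ) (by positivity) hδ hc
    have hϖ : 0 ≤ ϖ := le_trans (by positivity) (hw.bound 0 (Or.inr (by simp [hρ.le])) 0)
    refine ⟨CR * (ϖ * C), by positivity, fun τ hτ m => ?_⟩
    have h1 := hw.norm_le (Or.inr (ball_subset_closedBall hτ)) m
    have h2 := hgr τ (hU τ (Or.inr hτ)) (mem_ball_zero_iff.1 hτ).le
    have hm : (1 : ℝ) ≤ 1 + |m| := by simp
    have h3 : Real.exp (-P.β * |m|) ≤ 1 := Real.exp_le_one_iff.2 (by
      have := P.β_pos
      have : 0 ≤ P.β * |m| := by positivity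
      linarith)
    have h4 : (1 + |m|) ^ ((P.R P.D).natDegree : ℝ) * (1 + |m|) ^ (-P.μ) ≤ 1 := by
      rw [← Real.rpow_add (by linarith)]
      exact Real.rpow_le_one_of_one_le_of_nonpos hm (by linarith [P.lt_μ])
    rw [norm_mul]
    calc _ ≤ CR * (1 + |m|) ^ ((P.R P.D).natDegree : ℝ) * (ϖ * 1 * (1 + |m|) ^ (-P.μ) * C) := by
          refine mul_le_mul (hR m) (h1.trans ?_) (norm_nonneg _) (by positivity)
          gcongr
      _ = CR * (ϖ * C) * ((1 + |m|) ^ ((P.R P.D).natDegree : ℝ) * (1 + |m|) ^ (-P.μ)) := by ring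
      _ ≤ CR * (ϖ * C) := mul_le_of_le_one_right (by positivity) h4
  obtain ⟨A₁, hA₁0, hA₁⟩ := hbd U₁ w₁ c₁ hd₁ hd₁' hw₁
  obtain ⟨A₂, hA₂0, hA₂⟩ := hbd U₂ w₂ c₂ hd₂ hd₂' hw₂
  obtain ⟨Λ, hΛ, hcontr⟩ := exists_contraction P (A := A₁ + A₂) hsol₁ hsol₂ hε hψ
    (fun τ hτ => hw₁.continuous_right (Or.inr (ball_subset_closedBall hτ)))
    (fun τ hτ => hw₂.continuous_right (Or.inr (ball_subset_closedBall hτ)))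
    (fun τ hτ m => (hA₁ τ hτ m).trans (by linarith))
    (fun τ hτ m => (hA₂ τ hτ m).trans (by linarith))
  -- on the disc of radius `r` the contraction factor is at most `1 / 2`
  obtain ⟨r, hr0, hr1, hrρ, hrΛ⟩ : ∃ r : ℝ, 0 < r ∧ r ≤ 1 ∧ r < P.ρ ∧ r * Λ ≤ 1 / 2 := by
    refine ⟨min (min 1 (P.ρ / 2)) (1 / (2 * (Λ + 1))), by positivity,
      (min_le_left _ _).trans (min_le_left _ _),
      ((min_le_left _ _).trans (min_le_right _ _)).trans_lt (by linarith), ?_⟩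
    calc _ ≤ 1 / (2 * (Λ + 1)) * (Λ + 1) := by
          gcongr
          · exact min_le_right _ _
          · linarith
      _ = 1 / 2 := by field_simp
  have hiter : ∀ j : ℕ, ∀ τ : ℂ, τ ≠ 0 → ‖τ‖ ≤ r → ∀ m : ℝ,
      ‖(P.R P.D).eval (I * (m : ℂ)) * (w₁ τ m ε - w₂ τ m ε)‖ ≤ (1 / 2) ^ j * (A₁ + A₂) := by
    intro j
    induction j with
    | zero =>
      intro τ _ hτ m
      have hτ' : τ ∈ ball (0 : ℂ) P.ρ := by simpa using hτ.trans_lt hrρ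
      rw [mul_sub, pow_zero, one_mul]
      exact (norm_sub_le _ _).trans (add_le_add (hA₁ τ hτ' m) (hA₂ τ hτ' m))
    | succ j ih =>
      intro τ hτ0 hτ m
      have hτ' : τ ∈ ball (0 : ℂ) P.ρ := by simpa using hτ.trans_lt hrρ
      refine (hcontr τ hτ' hτ0 (hτ.trans hr1) _ (by positivity)
        (fun σ hσ0 hσ => ih σ hσ0 (hσ.trans hτ)) m).trans ?_
      rw [pow_succ', mul_assoc (1 / 2 : ℝ)]
      gcongr
      exact (mul_le_mul_of_nonneg_right hτ hΛ).trans hrΛ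
  have hzero : ∀ τ : ℂ, τ ≠ 0 → ‖τ‖ ≤ r → w₁ τ m ε = w₂ τ m ε := by
    intro τ hτ0 hτ
    have ht : Filter.Tendsto (fun j : ℕ => (1 / 2 : ℝ) ^ j * (A₁ + A₂)) Filter.atTop (𝓝 0) := by
      simpa using (tendsto_pow_atTop_nhds_zero_of_lt_one (by norm_num : (0 : ℝ) ≤ 1 / 2)
        (by norm_num)).mul_const (A₁ + A₂)
    have h1 := norm_le_zero_iff.1 (ge_of_tendsto' ht fun j => hiter j τ hτ0 hτ m)
    exact sub_eq_zero.1 ((mul_eq_zero.1 h1).resolve_left (P.RD_ne m))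
  have han : ∀ (U : Set ℂ) (w : ℂ → ℝ → ℂ → ℂ),
      MemExp P.q δ U P.kappa P.β P.μ α P.ρ (fun τ m => w τ m ε) ϖ →
      AnalyticOnNhd ℂ (fun τ => w τ m ε) (ball 0 P.ρ) := fun U w hw =>
    ((hw.holo m).mono subset_union_right).analyticOnNhd isOpen_ball
  have hr2 : ‖((r / 2 : ℝ) : ℂ)‖ = r / 2 := by
    rw [norm_real, Real.norm_of_nonneg (by positivity)]
  refine (han U₁ w₁ hw₁).eqOn_of_preconnected_of_eventuallyEq (han U₂ w₂ hw₂)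
    (convex_ball _ _).isPreconnected (z₀ := ((r / 2 : ℝ) : ℂ)) ?_ ?_
  · rw [mem_ball_zero_iff, hr2]
    linarith
  · have h1 : ∀ᶠ τ : ℂ in 𝓝 ((r / 2 : ℝ) : ℂ), τ ≠ 0 :=
      isOpen_ne.mem_nhds (norm_pos_iff.1 (by rw [hr2]; positivity))
    have h2 : ∀ᶠ τ : ℂ in 𝓝 ((r / 2 : ℝ) : ℂ), τ ∈ ball (0 : ℂ) r :=
      isOpen_ball.mem_nhds (by rw [mem_ball_zero_iff, hr2]; linarith)
    filter_upwards [h1, h2] with τ h1 h2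
    exact hzero τ h1 (mem_ball_zero_iff.1 h2).le

/-! ### Deformation of the contour -/

/-- Comparison of the integrals over two horizontal lines of functions that agree for
`Re Z ≤ s₀`: by Cauchy's theorem on `(-∞, s₀] × [g₁, g₂]` the left halves differ by the integral
over the vertical segment at `s₀`. -/
theorem integrable_and_norm_sub_le_of_eq_left {G₁ G₂ : ℂ → ℂ} {g₁ g₂ s₀ A b N : ℝ} (hA : 0 ≤ A)
    (hb : 1 / 2 ≤ b) (hG : ∀ Z : ℂ, Z.re ≤ s₀ → G₁ Z = G₂ Z)
    (hd : ∀ Z : ℂ, Z.re ≤ s₀ → Z.im ∈ uIcc g₁ g₂ → DifferentiableAt ℂ G₁ Z)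
    (hc₁ : Continuous fun s : ℝ => G₁ (s + g₁ * I)) (hc₂ : Continuous fun s : ℝ => G₂ (s + g₂ * I))
    (hfar₁ : ∀ s : ℝ, s₀ ≤ s → ‖G₁ (s + g₁ * I)‖ ≤ A * Real.exp (-b * s))
    (hfar₂ : ∀ s : ℝ, s₀ ≤ s → ‖G₂ (s + g₂ * I)‖ ≤ A * Real.exp (-b * s))
    (harc : ∀ y ∈ uIcc g₁ g₂, ‖G₁ (s₀ + y * I)‖ ≤ A * Real.exp (-b * s₀))
    (hnear : ∀ s : ℝ, s ≤ s₀ → ∀ y ∈ uIcc g₁ g₂, ‖G₁ (s + y * I)‖ ≤ N * Real.exp s) :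
    Integrable (fun s : ℝ => G₁ (s + g₁ * I)) ∧ Integrable (fun s : ℝ => G₂ (s + g₂ * I)) ∧
      ‖(∫ s : ℝ, G₂ (s + g₂ * I)) - ∫ s : ℝ, G₁ (s + g₁ * I)‖ ≤
        A * Real.exp (-b * s₀) * (4 + |g₁ - g₂|) := by
  have hb0 : -b < 0 := by linarith
  have hG' : ∀ s : ℝ, s ≤ s₀ → G₂ (s + g₂ * I) = G₁ (s + g₂ * I) := fun s hs =>
    (hG _ (by simpa using hs)).symm
  have hexp : IntegrableOn (fun s : ℝ => A * Real.exp (-b * s)) (Ioi s₀) :=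
    (integrableOn_exp_mul_Ioi hb0 s₀).const_mul A
  have hexp' : IntegrableOn (fun s : ℝ => N * Real.exp s) (Iic s₀) := by
    have := (integrableOn_exp_mul_Iic one_pos s₀).const_mul N
    simp only [one_mul] at this
    exact this
  have hr₁ : IntegrableOn (fun s : ℝ => G₁ (s + g₁ * I)) (Ioi s₀) :=
    Integrable.mono' hexp hc₁.aestronglyMeasurable
      ((ae_restrict_mem measurableSet_Ioi).mono fun s hs => hfar₁ s (le_of_lt hs))
  have hr₂ : IntegrableOn (fun s : ℝ => G₂ (s + g₂ * I)) (Ioi s₀) :=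
    Integrable.mono' hexp hc₂.aestronglyMeasurable
      ((ae_restrict_mem measurableSet_Ioi).mono fun s hs => hfar₂ s (le_of_lt hs))
  have hl₁ : IntegrableOn (fun s : ℝ => G₁ (s + g₁ * I)) (Iic s₀) :=
    Integrable.mono' hexp' hc₁.aestronglyMeasurable
      ((ae_restrict_mem measurableSet_Iic).mono fun s hs => hnear s hs _ left_mem_uIcc)
  have hl₂ : IntegrableOn (fun s : ℝ => G₂ (s + g₂ * I)) (Iic s₀) :=
    Integrable.mono' hexp' hc₂.aestronglyMeasurable
      ((ae_restrict_mem measurableSet_Iic).mono fun s hs => by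
        rw [hG' s hs]
        exact hnear s hs _ right_mem_uIcc)
  have hi : ∀ F : ℝ → ℂ, IntegrableOn F (Iic s₀) → IntegrableOn F (Ioi s₀) → Integrable F :=
    fun F h h' => by
      rw [← integrableOn_univ, ← Iic_union_Ioi (a := s₀)]
      exact h.union h'
  -- the right half-lines; `b ≥ 1 / 2` makes the constant `2` independent of `b`
  have hright : ∀ F : ℝ → ℂ, (∀ s : ℝ, s₀ ≤ s → ‖F s‖ ≤ A * Real.exp (-b * s)) →
      ‖∫ s in Ioi s₀, F s‖ ≤ 2 * (A * Real.exp (-b * s₀)) := fun F hF => by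
    refine (norm_integral_le_of_norm_le hexp ((ae_restrict_mem measurableSet_Ioi).mono
      fun s hs => hF s (le_of_lt hs))).trans ?_
    rw [integral_const_mul, integral_exp_mul_Ioi hb0, neg_div_neg_eq]
    have : Real.exp (-b * s₀) / b ≤ 2 * Real.exp (-b * s₀) := by
      rw [div_le_iff₀ (by linarith)]
      nlinarith [Real.exp_pos (-b * s₀)]
    calc _ ≤ A * (2 * Real.exp (-b * s₀)) := by gcongr
      _ = _ := by ring
  -- Cauchy's theorem on the rectangle `[S, s₀] × [g₁, g₂]`
  have hrect : ∀ S : ℝ, S ≤ s₀ →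
      ‖(∫ s in S..s₀, G₂ (s + g₂ * I)) - ∫ s in S..s₀, G₁ (s + g₁ * I)‖ ≤
        (A * Real.exp (-b * s₀) + N * Real.exp S) * |g₁ - g₂| := by
    intro S hS
    have h0 := integral_boundary_rect_eq_zero_of_differentiableOn G₁ ⟨S, g₁⟩ ⟨s₀, g₂⟩ (by
      intro Z hZ
      rw [mem_reProdIm] at hZ
      refine (hd Z ?_ hZ.2).differentiableWithinAt
      have := hZ.1.2
      simpa [hS] using this)
    have h1 : ∫ s in S..s₀, G₂ (s + g₂ * I) = ∫ s in S..s₀, G₁ (s + g₂ * I) :=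
      intervalIntegral.integral_congr fun s hs => by
        rw [uIcc_of_le hS] at hs
        exact hG' s hs.2
    simp only [smul_eq_mul] at h0
    have h2 : (∫ s in S..s₀, G₁ (s + g₂ * I)) - ∫ s in S..s₀, G₁ (s + g₁ * I) =
        I * (∫ y in g₁..g₂, G₁ (s₀ + y * I)) - I * ∫ y in g₁..g₂, G₁ (S + y * I) := by
      linear_combination -h0
    rw [h1, h2]
    have h3 := intervalIntegral.norm_integral_le_of_norm_le_const
      (f := fun y : ℝ => G₁ (s₀ + y * I)) (a := g₁) (b := g₂)
      fun y hy => harc y (uIoc_subset_uIcc hy)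
    have h4 := intervalIntegral.norm_integral_le_of_norm_le_const
      (f := fun y : ℝ => G₁ (S + y * I)) (a := g₁) (b := g₂)
      fun y hy => hnear S hS y (uIoc_subset_uIcc hy)
    refine (norm_sub_le _ _).trans ?_
    rw [norm_mul, norm_mul, norm_I, one_mul, one_mul, add_mul, abs_sub_comm]
    exact add_le_add h3 h4
  -- as `S → -∞` the left edge of the rectangle contributes nothing
  have hleft : ‖(∫ s in Iic s₀, G₂ (s + g₂ * I)) - ∫ s in Iic s₀, G₁ (s + g₁ * I)‖ ≤
      A * Real.exp (-b * s₀) * |g₁ - g₂| := by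
    have t1 := ((intervalIntegral_tendsto_integral_Iic s₀ hl₂ Filter.tendsto_id).sub
      (intervalIntegral_tendsto_integral_Iic s₀ hl₁ Filter.tendsto_id)).norm
    have t2 : Filter.Tendsto (fun S : ℝ => (A * Real.exp (-b * s₀) + N * Real.exp S) * |g₁ - g₂|)
        Filter.atBot (𝓝 ((A * Real.exp (-b * s₀) + N * 0) * |g₁ - g₂|)) :=
      ((Real.tendsto_exp_atBot.const_mul N).const_add _).mul_const _
    rw [mul_zero, add_zero] at t2
    exact le_of_tendsto_of_tendsto t1 t2
      ((Filter.eventually_le_atBot s₀).mono fun S hS => hrect S hS)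
  refine ⟨hi _ hl₁ hr₁, hi _ hl₂ hr₂, ?_⟩
  rw [← intervalIntegral.integral_Iic_add_Ioi hl₁ hr₁,
    ← intervalIntegral.integral_Iic_add_Ioi hl₂ hr₂, add_sub_add_comm]
  refine (norm_add_le _ _).trans ?_
  have h1 := (norm_sub_le _ _).trans (add_le_add (hright _ hfar₂) (hright _ hfar₁))
  linarith

theorem cos_le_max_cos {x y z : ℝ} (hx : 0 ≤ x) (hz : z ≤ 2 * Real.pi) (hxy : x ≤ y)
    (hyz : y ≤ z) : Real.cos y ≤ max (Real.cos x) (Real.cos z) := by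
  rcases le_total y Real.pi with h | h
  · exact le_max_of_le_left (Real.cos_le_cos_of_nonneg_of_le_pi hx h hxy)
  · refine le_max_of_le_right ?_
    rw [← Real.cos_two_pi_sub y, ← Real.cos_two_pi_sub z]
    exact Real.cos_le_cos_of_nonneg_of_le_pi (by linarith) (by linarith) (by linarith)

/-- The two directions have arguments such that the whole arc between them keeps the distance `η`
from the direction of `-T`: both arguments are taken in a period starting at `arg (-T)`. -/
theorem exists_arguments {γ₁ γ₂ η : ℝ} {T : ℂ} (h₁ : T ∈ laplaceDomain γ₁ η)
    (h₂ : T ∈ laplaceDomain γ₂ η) :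
    ∃ g₁ g₂ : ℝ, exp (g₁ * I) = exp (γ₁ * I) ∧ exp (g₂ * I) = exp (γ₂ * I) ∧
      |g₁ - g₂| ≤ 2 * Real.pi ∧
      ∀ y ∈ uIcc g₁ g₂, ∀ r : ℝ, 0 ≤ r → η ≤ ‖1 + exp (y * I) / T * (r : ℂ)‖ := by
  have hT : T ≠ 0 := h₁.1
  have hTn : 0 < ‖T‖ := norm_pos_iff.2 hT
  set t : ℝ := T.arg + Real.pi with ht
  have hπ : 0 < 2 * Real.pi := by positivity
  have hrep : ∀ γ : ℝ, ∃ g : ℝ, exp (g * I) = exp (γ * I) ∧ t ≤ g ∧ g ≤ t + 2 * Real.pi := by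
    intro γ
    refine ⟨toIcoMod hπ t γ, ?_, (toIcoMod_mem_Ico hπ t γ).1, (toIcoMod_mem_Ico hπ t γ).2.le⟩
    have h1 : toIcoMod hπ t γ = γ - toIcoDiv hπ t γ • (2 * Real.pi) := rfl
    rw [h1, exp_eq_exp_iff_exists_int, zsmul_eq_mul]
    refine ⟨-toIcoDiv hπ t γ, ?_⟩
    push_cast
    ring
  have hsq : ∀ y r : ℝ, ‖1 + exp (y * I) / T * (r : ℂ)‖ ^ 2 =
      1 - 2 * (r / ‖T‖) * Real.cos (y - t) + (r / ‖T‖) ^ 2 := by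
    intro y r
    have h1 : exp (y * I) / T * (r : ℂ) = ((r / ‖T‖ : ℝ) : ℂ) * exp ((y - T.arg : ℝ) * I) := by
      have h2 : (‖T‖ : ℂ) ≠ 0 := by exact_mod_cast hTn.ne'
      have h3 : exp (y * I) = exp ((y - T.arg : ℝ) * I) * exp (T.arg * I) := by
        rw [← exp_add]
        congr 1
        push_cast
        ring
      have h4 : exp (y * I) / T = exp ((y - T.arg : ℝ) * I) / ‖T‖ := by
        rw [div_eq_div_iff hT h2, h3, mul_assoc, mul_comm (exp (T.arg * I)),
          norm_mul_exp_arg_mul_I]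
      rw [h4, ofReal_div]
      ring
    have h6 : Real.cos (y - t) = -Real.cos (y - T.arg) := by
      rw [ht, ← sub_sub, Real.cos_sub_pi]
    rw [h1, h6, Complex.sq_norm, normSq_apply, add_re, add_im, re_ofReal_mul, im_ofReal_mul,
      exp_ofReal_mul_I_re, exp_ofReal_mul_I_im, one_re, one_im]
    linear_combination (r / ‖T‖) ^ 2 * Real.sin_sq_add_cos_sq (y - T.arg)
  obtain ⟨g₁, e₁, a₁, b₁⟩ := hrep γ₁
  obtain ⟨g₂, e₂, a₂, b₂⟩ := hrep γ₂
  refine ⟨g₁, g₂, e₁, e₂, abs_le.2 ⟨by linarith, by linarith⟩, fun y hy r hr => ?_⟩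
  have hcos : Real.cos (y - t) ≤ max (Real.cos (g₁ - t)) (Real.cos (g₂ - t)) := by
    rcases le_total g₁ g₂ with h | h
    · rw [uIcc_of_le h] at hy
      exact cos_le_max_cos (by linarith) (by linarith) (by linarith [hy.1]) (by linarith [hy.2])
    · rw [uIcc_of_ge h] at hy
      rw [max_comm]
      exact cos_le_max_cos (by linarith) (by linarith) (by linarith [hy.1]) (by linarith [hy.2])
  have hmono : ∀ g : ℝ, Real.cos (y - t) ≤ Real.cos (g - t) →
      ‖1 + exp (g * I) / T * (r : ℂ)‖ ≤ ‖1 + exp (y * I) / T * (r : ℂ)‖ := fun g hg => by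
    refine le_of_sq_le_sq ?_ (norm_nonneg _)
    rw [hsq, hsq]
    have : 0 ≤ r / ‖T‖ := by positivity
    nlinarith
  rcases le_max_iff.1 hcos with h | h
  · refine le_trans ?_ (hmono g₁ h)
    rw [e₁]
    exact (h₁.2 r hr).le
  · refine le_trans ?_ (hmono g₂ h)
    rw [e₂]
    exact (h₂.2 r hr).le

/-! ### The `q`-Laplace transform in the logarithmic variable -/

theorem laplaceIntegrand_exp {q k γ g : ℝ} (f : ℂ → ℂ) (T : ℂ) (hg : exp (g * I) = exp (γ * I))
    (s : ℝ) : |Real.exp s| • laplaceIntegrand q k γ f T (Real.exp s) =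
      f (exp (s + g * I)) / theta q k (exp (s + g * I) / T) := by
  have h1 : (Real.exp s : ℂ) ≠ 0 := by exact_mod_cast (Real.exp_pos s).ne'
  rw [laplaceIntegrand, exp_add, hg, ← ofReal_exp, abs_of_pos (Real.exp_pos s), real_smul,
    mul_div_cancel₀ _ h1]

theorem integrableOn_laplaceIntegrand_iff {q k γ g : ℝ} (f : ℂ → ℂ) (T : ℂ)
    (hg : exp (g * I) = exp (γ * I)) :
    IntegrableOn (laplaceIntegrand q k γ f T) (Ioi 0) ↔
      Integrable fun s : ℝ => f (exp (s + g * I)) / theta q k (exp (s + g * I) / T) := by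
  rw [← Real.range_exp, ← image_univ, integrableOn_image_iff_integrableOn_abs_deriv_smul
    MeasurableSet.univ (fun x _ => (Real.hasDerivAt_exp x).hasDerivWithinAt)
    Real.exp_injective.injOn, integrableOn_univ]
  simp only [laplaceIntegrand_exp f T hg]

theorem integral_laplaceIntegrand {q k γ g : ℝ} (f : ℂ → ℂ) (T : ℂ)
    (hg : exp (g * I) = exp (γ * I)) :
    ∫ r in Ioi (0 : ℝ), laplaceIntegrand q k γ f T r =
      ∫ s : ℝ, f (exp (s + g * I)) / theta q k (exp (s + g * I) / T) := by
  rw [← Real.range_exp, ← image_univ, integral_image_eq_integral_abs_deriv_smul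
    MeasurableSet.univ (fun x _ => (Real.hasDerivAt_exp x).hasDerivWithinAt)
    Real.exp_injective.injOn, Measure.restrict_univ]
  simp only [laplaceIntegrand_exp f T hg]

/-! ### Estimate of the difference of two transforms -/

theorem exp_div_eq {T : ℂ} (hT : T ≠ 0) (Z : ℂ) : exp Z / T = exp (Z - log T) := by
  rw [exp_sub, exp_log hT]

theorem le_norm_theta_div {q k η c : ℝ}
    (hΘ : ∀ Z : ℂ, (∀ r : ℝ, 0 ≤ r → η ≤ ‖1 + exp Z * (r : ℂ)‖) →
      c * Real.exp (k / (2 * Real.log q) * Z.re ^ 2 + Z.re / 2) ≤ ‖theta q k (exp Z)‖)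
    {T : ℂ} (hT : T ≠ 0) {y : ℝ} (hy : ∀ r : ℝ, 0 ≤ r → η ≤ ‖1 + exp (y * I) / T * (r : ℂ)‖)
    (s : ℝ) :
    c * Real.exp (k / (2 * Real.log q) * (s - Real.log ‖T‖) ^ 2 + (s - Real.log ‖T‖) / 2) ≤
      ‖theta q k (exp (s + y * I) / T)‖ := by
  have h1 := hΘ (s + y * I - log T) fun r hr => by
    have := hy (Real.exp s * r) (by positivity)
    rwa [ofReal_mul, ofReal_exp, ← mul_assoc, div_mul_eq_mul_div, mul_comm (exp _) (exp _),
      ← exp_add, exp_div_eq hT] at this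
  rw [exp_div_eq hT]
  simpa [log_re] using h1

/-- The integrand of the `q`-Laplace transform beyond a fixed radius: dividing by the theta function
trades the factor `exp (a log² |u|)` for `|u| ^ (2 a log |T|)`. -/
theorem norm_div_theta_le_far {a α c L s W : ℝ} {x t : ℂ} (hc : 0 < c)
    (ht : c * Real.exp (a * (s - L) ^ 2 + (s - L) / 2) ≤ ‖t‖)
    (hx : ‖x‖ ≤ W * Real.exp (a * s ^ 2 + α * s)) :
    ‖x / t‖ ≤ W / c * Real.exp (-a * L ^ 2 + L / 2) * Real.exp (-(1 / 2 - α - 2 * a * L) * s) := by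
  have h1 : 0 < c * Real.exp (a * (s - L) ^ 2 + (s - L) / 2) := by positivity
  rw [norm_div]
  refine (div_le_div₀ ((norm_nonneg _).trans hx) hx h1 ht).trans (le_of_eq ?_)
  rw [div_eq_iff h1.ne']
  have h2 : Real.exp (a * s ^ 2 + α * s) = Real.exp (-a * L ^ 2 + L / 2) *
      Real.exp (-(1 / 2 - α - 2 * a * L) * s) *
      Real.exp (a * (s - L) ^ 2 + (s - L) / 2) := by
    rw [← Real.exp_add, ← Real.exp_add]
    congr 1
    ring
  rw [h2]
  field_simp

/-- The integrand of the `q`-Laplace transform near the origin: the Gaussian growth of the theta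
function makes it decay like `|u|`, which justifies moving the left end of the contour to `-∞`. -/
theorem norm_div_theta_le_near {a c L s W : ℝ} {x t : ℂ} (ha : 0 < a) (hc : 0 < c)
    (ht : c * Real.exp (a * (s - L) ^ 2 + (s - L) / 2) ≤ ‖t‖) (hx : ‖x‖ ≤ W) :
    ‖x / t‖ ≤ W / c * Real.exp (9 / (16 * a) - L) * Real.exp s := by
  have h1 : 0 < c * Real.exp (a * (s - L) ^ 2 + (s - L) / 2) := by positivity
  have hW : 0 ≤ W := (norm_nonneg _).trans hx
  rw [norm_div]
  refine (div_le_div₀ hW hx h1 ht).trans ?_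
  rw [div_le_iff₀ h1]
  -- completing the square in `a t² + 3 t / 2`, with `t = s - L`
  have h2 : 1 ≤ Real.exp (9 / (16 * a) - L) * Real.exp s *
      Real.exp (a * (s - L) ^ 2 + (s - L) / 2) := by
    rw [← Real.exp_add, ← Real.exp_add]
    refine Real.one_le_exp ?_
    have : 9 / (16 * a) - L + s + (a * (s - L) ^ 2 + (s - L) / 2) =
        a * ((s - L) + 3 / (4 * a)) ^ 2 := by
      field_simp
      ring
    rw [this]
    positivity
  calc W ≤ W * _ := le_mul_of_one_le_right hW h2
    _ = _ := by field_simp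

/-- The difference of two `q`-Laplace transforms, in two directions, of functions that agree on a
disc and have the growth of the space `Exp` beyond radius `ρ / 2`. -/
theorem norm_qLaplace_sub_le {q k α η c ρ γ₁ γ₂ W N : ℝ} {U₁ U₂ : Set ℂ} {f₁ f₂ : ℂ → ℂ} {T : ℂ}
    (hq : 1 < q) (hk : 0 < k) (hρ : 0 < ρ) (hc : 0 < c) (hW : 0 ≤ W)
    (hΘ : ∀ Z : ℂ, (∀ r : ℝ, 0 ≤ r → η ≤ ‖1 + exp Z * (r : ℂ)‖) →
      c * Real.exp (k / (2 * Real.log q) * Z.re ^ 2 + Z.re / 2) ≤ ‖theta q k (exp Z)‖)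
    (hU₁ : ∀ r : ℝ, 0 < r → (r : ℂ) * exp (γ₁ * I) ∈ U₁)
    (hU₂ : ∀ r : ℝ, 0 < r → (r : ℂ) * exp (γ₂ * I) ∈ U₂)
    (hf₁ : ContinuousOn f₁ (U₁ ∪ closedBall 0 ρ)) (hf₂ : ContinuousOn f₂ (U₂ ∪ closedBall 0 ρ))
    (hd : DifferentiableOn ℂ f₁ (ball 0 ρ)) (heq : EqOn f₁ f₂ (ball 0 ρ))
    (hfar₁ : ∀ u ∈ U₁ ∪ ball (0 : ℂ) ρ, ρ / 2 ≤ ‖u‖ → ‖f₁ u‖ ≤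
      W * Real.exp (k / (2 * Real.log q) * Real.log ‖u‖ ^ 2 + α * Real.log ‖u‖))
    (hfar₂ : ∀ u ∈ U₂ ∪ ball (0 : ℂ) ρ, ρ / 2 ≤ ‖u‖ → ‖f₂ u‖ ≤
      W * Real.exp (k / (2 * Real.log q) * Real.log ‖u‖ ^ 2 + α * Real.log ‖u‖))
    (hnear : ∀ u ∈ ball (0 : ℂ) ρ, ‖f₁ u‖ ≤ N)
    (hT₁ : T ∈ laplaceDomain γ₁ η) (hT₂ : T ∈ laplaceDomain γ₂ η)
    (hT : α + 2 * (k / (2 * Real.log q)) * Real.log ‖T‖ < 0) :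
    IntegrableOn (laplaceIntegrand q k γ₁ f₁ T) (Ioi 0) ∧
    IntegrableOn (laplaceIntegrand q k γ₂ f₂ T) (Ioi 0) ∧
    ‖qLaplace q k γ₂ f₂ T - qLaplace q k γ₁ f₁ T‖ ≤ ‖1 / (piConst q k : ℂ)‖ *
      (W / c * Real.exp (-(k / (2 * Real.log q)) * Real.log ‖T‖ ^ 2 + Real.log ‖T‖ / 2) *
        Real.exp (-(1 / 2 - α - 2 * (k / (2 * Real.log q)) * Real.log ‖T‖) * Real.log (ρ / 2)) *
        (4 + 2 * Real.pi)) := by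
  have hlog := Real.log_pos hq
  have hT0 : T ≠ 0 := hT₁.1
  set a := k / (2 * Real.log q) with ha
  have ha0 : 0 < a := by positivity
  set L := Real.log ‖T‖ with hL
  set s₀ := Real.log (ρ / 2) with hs₀
  have hρ2 : 0 < ρ / 2 := by positivity
  have hes₀ : Real.exp s₀ = ρ / 2 := Real.exp_log hρ2
  obtain ⟨g₁, g₂, e₁, e₂, hg, harg⟩ := exists_arguments hT₁ hT₂
  have hlow : ∀ y ∈ uIcc g₁ g₂, ∀ s : ℝ,
      c * Real.exp (a * (s - L) ^ 2 + (s - L) / 2) ≤ ‖theta q k (exp (s + y * I) / T)‖ :=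
    fun y hy s => le_norm_theta_div hΘ hT0 (harg y hy) s
  have hne : ∀ y ∈ uIcc g₁ g₂, ∀ s : ℝ, theta q k (exp (s + y * I) / T) ≠ 0 := fun y hy s =>
    norm_pos_iff.1 (lt_of_lt_of_le (by positivity) (hlow y hy s))
  have hnorm : ∀ s y : ℝ, ‖exp (s + y * I)‖ = Real.exp s := fun s y => by
    simp [norm_exp]
  have hlogn : ∀ s y : ℝ, Real.log ‖exp (s + y * I)‖ = s := fun s y => by
    rw [hnorm, Real.log_exp]
  have hball : ∀ Z : ℂ, Z.re ≤ s₀ → exp Z ∈ ball (0 : ℂ) ρ := fun Z hZ => by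
    rw [mem_ball_zero_iff, norm_exp]
    have := Real.exp_le_exp.2 hZ
    linarith
  have hnfar : ∀ s y : ℝ, s₀ ≤ s → ρ / 2 ≤ ‖exp (s + y * I)‖ := fun s y hs => by
    rw [hnorm, ← hes₀]
    exact Real.exp_le_exp.2 hs
  have hray : ∀ (U : Set ℂ) (γ g : ℝ), exp (g * I) = exp (γ * I) →
      (∀ r : ℝ, 0 < r → (r : ℂ) * exp (γ * I) ∈ U) → ∀ s : ℝ, exp (s + g * I) ∈ U :=
    fun U γ g hg hU s => by
      rw [exp_add, hg, ← ofReal_exp]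
      exact hU _ (Real.exp_pos s)
  have hΘc : Differentiable ℂ fun Z => theta q k (exp Z / T) := by
    simp only [exp_div_eq hT0]
    exact (differentiable_theta_exp hq hk).comp (differentiable_id.sub_const _)
  have hcont : ∀ (U : Set ℂ) (f : ℂ → ℂ) (γ g : ℝ), exp (g * I) = exp (γ * I) → g ∈ uIcc g₁ g₂ →
      (∀ r : ℝ, 0 < r → (r : ℂ) * exp (γ * I) ∈ U) → ContinuousOn f (U ∪ closedBall 0 ρ) →
      Continuous fun s : ℝ => f (exp (s + g * I)) / theta q k (exp (s + g * I) / T) :=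
    fun U f γ g hg hg' hU hf =>
      (hf.comp_continuous (by fun_prop) fun s => Or.inl (hray U γ g hg hU s)).div
        (hΘc.continuous.comp (f := fun s : ℝ => (s + g * I : ℂ)) (by fun_prop)) (hne g hg')
  have hfar : ∀ (U : Set ℂ) (f : ℂ → ℂ), (∀ u ∈ U ∪ ball (0 : ℂ) ρ, ρ / 2 ≤ ‖u‖ →
      ‖f u‖ ≤ W * Real.exp (a * Real.log ‖u‖ ^ 2 + α * Real.log ‖u‖)) →
      ∀ s y : ℝ, y ∈ uIcc g₁ g₂ → s₀ ≤ s → exp (s + y * I) ∈ U ∪ ball (0 : ℂ) ρ →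
      ‖f (exp (s + y * I)) / theta q k (exp (s + y * I) / T)‖ ≤
        W / c * Real.exp (-a * L ^ 2 + L / 2) * Real.exp (-(1 / 2 - α - 2 * a * L) * s) := by
    intro U f hf s y hy hs hu
    refine norm_div_theta_le_far hc (hlow y hy s) ?_
    have := hf _ hu (hnfar s y hs)
    rwa [hlogn] at this
  have key := integrable_and_norm_sub_le_of_eq_left
    (G₁ := fun Z => f₁ (exp Z) / theta q k (exp Z / T))
    (G₂ := fun Z => f₂ (exp Z) / theta q k (exp Z / T)) (g₁ := g₁) (g₂ := g₂) (s₀ := s₀)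
    (A := W / c * Real.exp (-a * L ^ 2 + L / 2)) (b := 1 / 2 - α - 2 * a * L)
    (N := N / c * Real.exp (9 / (16 * a) - L)) (by positivity) (by linarith)
    (fun Z hZ => congrArg (· / theta q k (exp Z / T)) (heq (hball Z hZ)))
    (fun Z hZ hy => by
      have h1 : DifferentiableAt ℂ f₁ (exp Z) :=
        hd.differentiableAt (isOpen_ball.mem_nhds (hball Z hZ))
      have h2 := hne _ hy Z.re
      rw [re_add_im] at h2
      exact (h1.comp Z differentiableAt_exp).div (hΘc Z) h2)
    (hcont U₁ f₁ γ₁ g₁ e₁ left_mem_uIcc hU₁ hf₁) (hcont U₂ f₂ γ₂ g₂ e₂ right_mem_uIcc hU₂ hf₂)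
    (fun s hs => hfar U₁ f₁ hfar₁ s g₁ left_mem_uIcc hs (Or.inl (hray U₁ γ₁ g₁ e₁ hU₁ s)))
    (fun s hs => hfar U₂ f₂ hfar₂ s g₂ right_mem_uIcc hs (Or.inl (hray U₂ γ₂ g₂ e₂ hU₂ s)))
    (fun y hy => hfar U₁ f₁ hfar₁ s₀ y hy le_rfl (Or.inr (hball _ (by simp))))
    (fun s hs y hy => norm_div_theta_le_near ha0 hc (hlow y hy s)
      (hnear _ (hball _ (by simpa using hs))))
  refine ⟨(integrableOn_laplaceIntegrand_iff f₁ T e₁).2 key.1,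
    (integrableOn_laplaceIntegrand_iff f₂ T e₂).2 key.2.1, ?_⟩
  rw [qLaplace, qLaplace, integral_laplaceIntegrand f₁ T e₁, integral_laplaceIntegrand f₂ T e₂,
    ← mul_sub, norm_mul]
  refine mul_le_mul_of_nonneg_left (key.2.2.trans ?_) (norm_nonneg _)
  gcongr

theorem ray_mem_unboundedSector {d θ : ℝ} (hθ : 0 < θ) {r : ℝ} (hr : 0 < r) :
    (r : ℂ) * exp (d * I) ∈ unboundedSector d θ :=
  ⟨r, hr, d, by simpa using hθ, rfl⟩

theorem infDist_neg_le_norm_add {δ : ℝ} {S : Set ℂ} {u : ℂ} (hu : u ∈ S) :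
    infDist (-(δ : ℂ)) S ≤ ‖u + (δ : ℂ)‖ := by
  have := infDist_le_dist_of_mem (x := -(δ : ℂ)) hu
  rwa [dist_comm, dist_eq_norm, sub_neg_eq_add] at this

end QDiff

theorem lemma1031
    (P : QDiff.EquationData)
    (δ α η rT ϖ : ℝ) (hδ : 0 < δ) (hη : 0 < η) (hϖ : 0 < ϖ)
    (hε₀ : P.ε₀ < 1) (hrT : 0 < rT) (hrT' : rT < 1)
    (hα : α + P.kappa / Real.log P.q * Real.log (P.ε₀ * rT) < 0)
    (n : ℕ) [NeZero n] (hn : 2 ≤ n)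
    (E : Fin n → Set ℂ) (hE : QDiff.IsGoodCovering P.ε₀ E)
    (dir θ : Fin n → ℝ) (hθ : ∀ p, 0 < θ p)
    (hdist : ∀ p, 0 < Metric.infDist (-(δ : ℂ))
      (QDiff.unboundedSector (dir p) (θ p) ∪ Metric.ball 0 P.ρ))
    (ψ w : Fin n → ℂ → ℝ → ℂ → ℂ)
    (hψ : ∀ p, P.IsForcing δ α (QDiff.unboundedSector (dir p) (θ p)) (ψ p))
    (hw : ∀ p, ∀ ε ∈ Metric.ball (0 : ℂ) P.ε₀,
      QDiff.MemExp P.q δ (QDiff.unboundedSector (dir p) (θ p)) P.kappa P.β P.μ α P.ρ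
        (fun τ m => w p τ m ε) ϖ)
    (hsol : ∀ p, P.IsSolution (QDiff.unboundedSector (dir p) (θ p)) (ψ p) (w p))
    (p : Fin n)
    (hdisj : QDiff.unboundedSector (dir p) (θ p) ∩
      QDiff.unboundedSector (dir (p + 1)) (θ (p + 1)) = ∅) :
    ∃ K : ℝ, 0 < K ∧ ∃ M : ℝ,
      ∀ ε ∈ E p ∩ E (p + 1),
      ∀ τ ∈ (QDiff.laplaceDomain (dir p) η ∩ Metric.ball 0 (P.ε₀ * rT)) ∩
        (QDiff.laplaceDomain (dir (p + 1)) η ∩ Metric.ball 0 (P.ε₀ * rT)),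
      ∀ m : ℝ,
        MeasureTheory.IntegrableOn
          (QDiff.laplaceIntegrand P.q P.kappa (dir p) (fun u => w p u m ε) τ)
          (Set.Ioi (0 : ℝ)) ∧
        MeasureTheory.IntegrableOn
          (QDiff.laplaceIntegrand P.q P.kappa (dir (p + 1)) (fun u => w (p + 1) u m ε) τ)
          (Set.Ioi (0 : ℝ)) ∧
        ‖QDiff.qLaplace P.q P.kappa (dir (p + 1)) (fun u => w (p + 1) u m ε) τ -
            QDiff.qLaplace P.q P.kappa (dir p) (fun u => w p u m ε) τ‖ ≤
          K * Real.exp (-P.β * |m|) * (1 + |m|) ^ (-P.μ) *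
            Real.exp (-(P.kappa / (2 * Real.log P.q)) * Real.log ‖τ‖ ^ 2) * ‖τ‖ ^ M := by
  have hlog := Real.log_pos P.one_lt_q
  have hκ := P.kappa_pos
  have hρ := P.ρ_pos
  have hε₀p := P.ε₀_pos
  set a := P.kappa / (2 * Real.log P.q) with ha
  have ha0 : 0 < a := by positivity
  obtain ⟨c, hc, hΘ⟩ := QDiff.exists_le_norm_theta P.one_lt_q hκ hη
  have hfar := fun p => QDiff.exists_growth_le_of_le_norm (a := a) (α := α) ha0.le hδ (hdist p)
    (half_pos hρ)
  obtain ⟨N₀, hN₀, hnear⟩ := QDiff.exists_growth_le_of_norm_le (a := a) (α := α) (R := P.ρ)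
    ha0.le hδ (hdist p)
  choose C hC hgr using hfar
  set s₀ := Real.log (P.ρ / 2) with hs₀
  set B := max (C p) (C (p + 1)) with hB
  have hB0 : 0 < B := lt_max_of_lt_left (hC p)
  set K := ‖1 / (QDiff.piConst P.q P.kappa : ℂ)‖ *
    (ϖ * B / c * Real.exp (-(1 / 2 - α) * s₀) * (4 + 2 * Real.pi)) with hK
  have hK0 : 0 ≤ K := by positivity
  -- adding `1` only makes the constant positive
  refine ⟨K + 1, by positivity, 1 / 2 + 2 * a * s₀, fun ε hε τ hτ m => ?_⟩
  have hε' : ε ∈ ball (0 : ℂ) P.ε₀ := by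
    obtain ⟨b, t, -, hE'⟩ := hE.sector p
    have := hε.1
    rw [hE'] at this
    exact this.2
  have hτ0 : 0 < ‖τ‖ := norm_pos_iff.2 hτ.1.1.1
  have hτ1 : ‖τ‖ < P.ε₀ * rT := mem_ball_zero_iff.1 hτ.1.2
  have hT : α + 2 * a * Real.log ‖τ‖ < 0 := by
    have h1 := Real.log_lt_log hτ0 hτ1
    have h2 : 2 * a = P.kappa / Real.log P.q := by
      rw [ha]
      field_simp
    have h3 := mul_lt_mul_of_pos_left h1 (div_pos hκ hlog)
    rw [h2]
    linarith
  set V := Real.exp (-P.β * |m|) * (1 + |m|) ^ (-P.μ) with hV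
  have hV0 : 0 < V := by positivity
  have hbd : ∀ p', C p' ≤ B → ∀ u ∈ QDiff.unboundedSector (dir p') (θ p') ∪ ball (0 : ℂ) P.ρ,
      P.ρ / 2 ≤ ‖u‖ → ‖w p' u m ε‖ ≤
        ϖ * V * B * Real.exp (a * Real.log ‖u‖ ^ 2 + α * Real.log ‖u‖) := by
    intro p' hp' u hu hun
    have h1 := (hw p' ε hε').norm_le (union_subset_union_right _ ball_subset_closedBall hu) m
    have h2 := hgr p' u (QDiff.infDist_neg_le_norm_add hu) hun
    refine h1.trans ?_
    rw [mul_assoc ϖ, mul_assoc (ϖ * V)]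
    refine mul_le_mul_of_nonneg_left (h2.trans ?_) (by positivity)
    gcongr
  have heq := QDiff.eqOn_ball_of_isSolution P hδ (hdist p)
    (fun u hu => QDiff.infDist_neg_le_norm_add hu) (hdist (p + 1))
    (fun u hu => QDiff.infDist_neg_le_norm_add hu) (hψ p) (hψ (p + 1)) hε' (hw p ε hε')
    (hw (p + 1) ε hε') (hsol p) (hsol (p + 1)) m
  have key := QDiff.norm_qLaplace_sub_le (N := ϖ * V * N₀) P.one_lt_q hκ hρ hc
    (by positivity : 0 ≤ ϖ * V * B) hΘ
    (fun r hr => QDiff.ray_mem_unboundedSector (hθ p) hr)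
    (fun r hr => QDiff.ray_mem_unboundedSector (hθ (p + 1)) hr)
    ((hw p ε hε').continuousOn_left m) ((hw (p + 1) ε hε').continuousOn_left m)
    (((hw p ε hε').holo m).mono subset_union_right) heq
    (hbd p (le_max_left _ _)) (hbd (p + 1) (le_max_right _ _))
    (fun u hu => by
      refine ((hw p ε hε').norm_le (Or.inr (ball_subset_closedBall hu)) m).trans ?_
      rw [mul_assoc ϖ]
      exact mul_le_mul_of_nonneg_left (hnear u (QDiff.infDist_neg_le_norm_add (Or.inr hu))
        (mem_ball_zero_iff.1 hu).le) (by positivity))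
    hτ.1.1 hτ.2.1 hT
  refine ⟨key.1, key.2.1, key.2.2.trans ?_⟩
  -- the factor `(ρ / 2) ^ (2 a log |τ|) |τ| ^ (1 / 2)` is the power of `|τ|` in the claim
  have hexp : Real.exp (-a * Real.log ‖τ‖ ^ 2 + Real.log ‖τ‖ / 2) *
      Real.exp (-(1 / 2 - α - 2 * a * Real.log ‖τ‖) * s₀) =
      Real.exp (-(1 / 2 - α) * s₀) * (Real.exp (-a * Real.log ‖τ‖ ^ 2) *
        ‖τ‖ ^ (1 / 2 + 2 * a * s₀)) := by
    rw [Real.rpow_def_of_pos hτ0, ← Real.exp_add, ← Real.exp_add, ← Real.exp_add]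
    congr 1
    ring
  calc _ = K * (V * (Real.exp (-a * Real.log ‖τ‖ ^ 2) * ‖τ‖ ^ (1 / 2 + 2 * a * s₀))) := by
        rw [mul_assoc (ϖ * V * B / c), hexp, hK]
        ring
    _ ≤ (K + 1) * (V * (Real.exp (-a * Real.log ‖τ‖ ^ 2) * ‖τ‖ ^ (1 / 2 + 2 * a * s₀))) := by
        gcongr
        linarith
    _ = _ := by
        rw [hV]
        ring
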